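/- Let $k$ be a field. A layered graph is a directed graph $\Gamma=(V,E)$ with tail and head maps $t,h:E\to V$, whose vertices have levels $0,\dots,N$, with a unique vertex $*$ of level $0$, such that every edge goes from some level $i$ to level $i-1$ and every vertex $\neq *$ is the tail of an edge; the level of an edge is the level of its tail. For a path $\pi=(e_1,\dots,e_m)$ and $1\le j\le m$ put $e(\pi,j)=\sum_{1\le i_1<\dots<i_j\le m}e_{i_1}\cdots e_{i_j}$ in the free associative algebra $T(E)$ over $k$, and let $A(\Gamma)=T(E)/R$, where $R$ is the two-sided ideal generated by all $e(\pi_1,j)-e(\pi_2,j)$ with $\pi_1,\pi_2$ paths having the same starting vertex and the same end vertex and $1\le j\le \mathrm{length}(\pi_1)$. Let $\mathrm{Aut}(A(\Gamma))$ be the group of $k$-algebra automorphisms of $A(\Gamma)$ that preserve both the grading by degree in the edges and the increasing filtration whose $i$-th term is spanned by the products of edges with sum of levels at most $i$. For $n\ge 3$ let $\Gamma_{D_n}$ be the Hasse graph of an $n$-gon: its vertices are $*$ (level 0), $w_i$ (level 1), $v_{i\,i+1}$ (level 2), for $i\in\mathbb Z/n$, and $u$ (level 3), and its edges are $u\to v_{i\,i+1}$,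 $v_{i\,i+1}\to w_i$, $v_{i\,i+1}\to w_{i+1}$, $w_i\to *$. Let $\Gamma_{D_2}$ be the graph with vertices $*$ (level 0), $w_1,w_2$ (level 1), $v_{12}$ (level 2), and edges $v_{12}\to w_1$, $v_{12}\to w_2$, $w_1\to *$, $w_2\to *$. (a) If $n\ge3$, then $\mathrm{Aut}(A(\Gamma_{D_n}))=k^*\times D_n$: the dihedral group $D_n$ of order $2n$, acting on the $n$-gon by rotations and reflections, is the automorphism group of the graph $\Gamma_{D_n}$, and $(\alpha,g)\mapsto(e\mapsto\alpha\, g(e)$ for every edge $e)$ is an isomorphism from $k^*\times D_n$ onto $\mathrm{Aut}(A(\Gamma_{D_n}))$. (b) For $n=2$, the set $$H=\left\{M\in GL(3,k): M=\begin{bmatrix}c_1^1+c_2^1&c_1^2-c_2^1&c_2^1-c_1^2\\0&c_1^1&c_2^1\\0&c_1^2&c_1^1+c_2^1-c_1^2\end{bmatrix},\ c_1^1,c_2^1,c_1^2\in k\right\}$$ is a subgroup of $GL(3,k)$ and $\mathrm{Aut}(A(\Gamma_{D_2}))\cong H$. More precisely, write $v_{12},w_1,w_2\in A(\Gamma_{D_2})$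 also for the classes of $e(\pi,1)$, $\pi$ any path from the respective vertex to $*$. There is a group isomorphism $\Phi:\mathrm{Aut}(A(\Gamma_{D_2}))\to H$ such that each automorphism $\sigma$ maps $rv_{12}+sw_1+tw_2$ to the element with coordinate row vector $[r\ s\ t]\,M_\sigma$, where $M_\sigma=\Phi(\sigma)^{-1}$. -/

import Mathlib

/-- A layered directed graph with a unique vertex `star` of level `0`, bounded levels, edges going
down one level, and at least one edge leaving every vertex of positive level. -/
structure LayeredGraph where
  V : Type
  E : Type
  tail : E → V
  head : E → V
  level : V → ℕ
  star : V
  level_tail : ∀ e, level (tail e) = level (head e) + 1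
  level_eq_zero_iff : ∀ x, level x = 0 ↔ x = star
  level_bounded : ∃ N, ∀ x, level x ≤ N
  exists_edge : ∀ x, x ≠ star → ∃ e, tail e = x

namespace LayeredGraph

/-- `Γ.IsPath x π y`: the sequence of edges `π` is a path from `x` to `y`. -/
def IsPath (Γ : LayeredGraph) : Γ.V → List Γ.E → Γ.V → Prop
  | x, [], y => x = y
  | x, e :: π, y => Γ.tail e = x ∧ Γ.IsPath (Γ.head e) π y

/-- `e(π, m) = ∑ e_{i₁} ⋯ e_{iₘ}`, the sum over `i₁ < ⋯ < iₘ`, in the free algebra on the edges. -/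
def pathElem (k : Type*) [Field k] (Γ : LayeredGraph) (π : List Γ.E) (m : ℕ) :
    FreeAlgebra k Γ.E :=
  ((π.sublistsLen m).map fun l => (l.map (FreeAlgebra.ι k)).prod).sum

/-- The defining relations `e(π₁, m) = e(π₂, m)` for paths with the same end points. -/
inductive Rel (k : Type*) [Field k] (Γ : LayeredGraph) :
    FreeAlgebra k Γ.E → FreeAlgebra k Γ.E → Prop
  | mk (x y : Γ.V) (π₁ π₂ : List Γ.E) (h₁ : Γ.IsPath x π₁ y) (h₂ : Γ.IsPath x π₂ y)
      (m : ℕ) (hm : 1 ≤ m) (hm' : m ≤ π₁.length) :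
      Rel k Γ (pathElem k Γ π₁ m) (pathElem k Γ π₂ m)

/-- The algebra `A(Γ)`: the free algebra on the edges modulo the two-sided ideal generated by
the defining relations. -/
abbrev Alg (k : Type*) [Field k] (Γ : LayeredGraph) := RingQuot (Rel k Γ)

/-- The quotient map from the free algebra on the edges to `A(Γ)`. -/
def proj (k : Type*) [Field k] (Γ : LayeredGraph) : FreeAlgebra k Γ.E →ₐ[k] Alg k Γ :=
  RingQuot.mkAlgHom k (Rel k Γ)

/-- The class of an edge in `A(Γ)`. -/
def edge (k : Type*) [Field k] (Γ : LayeredGraph) (e : Γ.E) : Alg k Γ :=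
  proj k Γ (FreeAlgebra.ι k e)

/-- The homogeneous component `A(Γ)_[i]`, spanned by the products of `i` edges. -/
def component (k : Type*) [Field k] (Γ : LayeredGraph) (i : ℕ) : Submodule k (Alg k Γ) :=
  Submodule.span k {a | ∃ l : List Γ.E, l.length = i ∧ a = (l.map (edge k Γ)).prod}

/-- The level filtration `A(Γ)_(i)`, spanned by the products of edges whose levels (the level of
an edge being that of its tail) have sum at most `i`. -/
def filtration (k : Type*) [Field k] (Γ : LayeredGraph) (i : ℕ) : Submodule k (Alg k Γ) :=
  Submodule.span k {a | ∃ l : List Γ.E, (l.map fun e => Γ.level (Γ.tail e)).sum ≤ i ∧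
    a = (l.map (edge k Γ)).prod}

/-- `Aut(A(Γ))`: the `k`-algebra automorphisms which preserve the grading by degree and the
filtration by level. The group law is composition. -/
def autAlg (k : Type*) [Field k] (Γ : LayeredGraph) : Subgroup (Alg k Γ ≃ₐ[k] Alg k Γ) where
  carrier := {σ | ∀ i a, (σ a ∈ component k Γ i ↔ a ∈ component k Γ i) ∧
    (σ a ∈ filtration k Γ i ↔ a ∈ filtration k Γ i)}
  one_mem' := fun _ _ => ⟨Iff.rfl, Iff.rfl⟩
  mul_mem' := fun {σ τ} hσ hτ i a =>
    ⟨(hσ i (τ a)).1.trans (hτ i a).1, (hσ i (τ a)).2.trans (hτ i a).2⟩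
  inv_mem' := fun {σ} hσ i a => by
    have h := hσ i (σ⁻¹ a)
    have e : σ (σ⁻¹ a) = a := σ.apply_symm_apply a
    rw [e] at h
    exact ⟨h.1.symm, h.2.symm⟩

/-- `Aut(Γ)`: pairs of permutations of the vertices and of the edges compatible with tails and
heads. -/
def autGraph (Γ : LayeredGraph) : Subgroup (Equiv.Perm Γ.V × Equiv.Perm Γ.E) where
  carrier := {p | ∀ e, Γ.tail (p.2 e) = p.1 (Γ.tail e) ∧ Γ.head (p.2 e) = p.1 (Γ.head e)}
  one_mem' := fun _ => ⟨rfl, rfl⟩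
  mul_mem' := fun {p q} hp hq e =>
    ⟨(hp (q.2 e)).1.trans (congrArg p.1 (hq e).1), (hp (q.2 e)).2.trans (congrArg p.1 (hq e).2)⟩
  inv_mem' := fun {p} hp e => by
    have h := hp (p.2⁻¹ e)
    have he : p.2 (p.2⁻¹ e) = e := p.2.apply_symm_apply e
    rw [he] at h
    constructor
    · exact p.1.injective (h.1.symm.trans (p.1.apply_symm_apply _).symm)
    · exact p.1.injective (h.2.symm.trans (p.1.apply_symm_apply _).symm)

end LayeredGraph

/-- Vertices of the Hasse graph of an `n`-gon, with indices modulo `n`: the minimal vertex `star`,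
the corners `w i`, the sides `v i` (joining the corners `i` and `i + 1`), and the top `u`. -/
inductive PolygonVertex (n : ℕ) : Type
  | star : PolygonVertex n
  | w (i : ZMod n) : PolygonVertex n
  | v (i : ZMod n) : PolygonVertex n
  | u : PolygonVertex n

/-- Edges of the Hasse graph of an `n`-gon: `u → v i`, `v i → w i`, `v i → w (i + 1)` and
`w i → star`. -/
inductive PolygonEdge (n : ℕ) : Type
  | uv (i : ZMod n) : PolygonEdge n
  | vw (i : ZMod n) : PolygonEdge n
  | vw' (i : ZMod n) : PolygonEdge n
  | ws (i : ZMod n) : PolygonEdge n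

/-- The Hasse graph `Γ_{D_n}` of an `n`-gon (meant for `n ≥ 3`). -/
def polygonGraph (n : ℕ) : LayeredGraph where
  V := PolygonVertex n
  E := PolygonEdge n
  tail
    | .uv _ => .u
    | .vw i => .v i
    | .vw' i => .v i
    | .ws i => .w i
  head
    | .uv i => .v i
    | .vw i => .w i
    | .vw' i => .w (i + 1)
    | .ws _ => .star
  level
    | .star => 0
    | .w _ => 1
    | .v _ => 2
    | .u => 3
  star := .star
  level_tail := by rintro (_ | _ | _ | _) <;> rfl
  level_eq_zero_iff := by rintro (_ | _ | _ | _) <;> simp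
  level_bounded := ⟨3, by rintro (_ | _ | _ | _) <;> simp⟩
  exists_edge := by
    rintro (_ | i | i | _) h
    · exact absurd rfl h
    · exact ⟨.ws i, rfl⟩
    · exact ⟨.vw i, rfl⟩
    · exact ⟨.uv 0, rfl⟩

/-- Vertices of `Γ_{D_2}`: a `2`-gon has two corners `w₁`, `w₂` and the single side `v₁₂`, which is
also its top face. -/
inductive DigonVertex : Type
  | star : DigonVertex
  | w₁ : DigonVertex
  | w₂ : DigonVertex
  | v₁₂ : DigonVertex

/-- Edges of `Γ_{D_2}`: `v₁₂ → w₁`, `v₁₂ → w₂`, `w₁ → star` and `w₂ → star`. -/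
inductive DigonEdge : Type
  | f₁ : DigonEdge
  | f₂ : DigonEdge
  | g₁ : DigonEdge
  | g₂ : DigonEdge

/-- The Hasse graph `Γ_{D_2}` of a `2`-gon. -/
def digonGraph : LayeredGraph where
  V := DigonVertex
  E := DigonEdge
  tail
    | .f₁ => .v₁₂
    | .f₂ => .v₁₂
    | .g₁ => .w₁
    | .g₂ => .w₂
  head
    | .f₁ => .w₁
    | .f₂ => .w₂
    | .g₁ => .star
    | .g₂ => .star
  level
    | .star => 0
    | .w₁ => 1
    | .w₂ => 1
    | .v₁₂ => 2
  star := .star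
  level_tail := by rintro (_ | _ | _ | _) <;> rfl
  level_eq_zero_iff := by rintro (_ | _ | _ | _) <;> simp
  level_bounded := ⟨2, by rintro (_ | _ | _ | _) <;> simp⟩
  exists_edge := by
    rintro (_ | _ | _ | _) h
    · exact absurd rfl h
    · exact ⟨.g₁, rfl⟩
    · exact ⟨.g₂, rfl⟩
    · exact ⟨.f₁, rfl⟩

/-- The generators `v₁₂`, `w₁`, `w₂` of `A(Γ_{D_2})`. The generator attached to a vertex is the
class of `e(π, 1)` for a path `π` from this vertex to `star`; it does not depend on `π`. -/
def digonGen (k : Type*) [Field k] : Fin 3 → LayeredGraph.Alg k digonGraph :=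
  ![LayeredGraph.proj k digonGraph (LayeredGraph.pathElem k digonGraph [.f₁, .g₁] 1),
    LayeredGraph.proj k digonGraph (LayeredGraph.pathElem k digonGraph [.g₁] 1),
    LayeredGraph.proj k digonGraph (LayeredGraph.pathElem k digonGraph [.g₂] 1)]

/-- The matrix with parameters `a = c_1^1`, `b = c_2^1`, `c = c_1^2`. -/
def digonMatrix {k : Type*} [Field k] (a b c : k) : Matrix (Fin 3) (Fin 3) k :=
  !![a + b, c - b, b - c;
     0,     a,     b;
     0,     c,     a + b - c]

/-! Every edge is a difference of two vertex generators, the generator of a vertex being the class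
of `e(π, 1)` for a path `π` down to `star`. An automorphism is therefore determined by the images of
these generators. The generators of the vertices other than `star` form a basis of the degree-one
part, so these images have coordinates, and the filtration makes the coordinate matrix block
triangular by level.

The constraints come from degree two. A bilinear form `β` on vertex vectors that respects the
relations (`Admissible`) gives a representation of `A(Γ)` on `k × X × k` in which products of three
edges vanish (`truncRep`). It reads off degree-one coordinates and the value of `β` on degree-two
products. Applying an automorphism to a square `ab = cd` of edges and then evaluating `β` yields
polynomial equations in the coordinates (`form_autCoord_eq`). No basis of the algebra is needed.

For the polygon, well-chosen forms show that the images of two neighbouring corners differ by a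
multiple of the difference of the two corners of one side. From this each corner goes to a multiple
of a corner, neighbours stay neighbours and the multiple is constant (`exists_polygonCoord_w_eq`).
Such a map of corners is dihedral because `n ≥ 3`. After dividing by the corresponding element of
`kˣ × D_n` the corners are fixed, and the remaining equations force the identity
(`polygon_aut_eq_one`).

For the digon there is a single square. Its equations give exactly the shape `digonMatrix`
(`digonAutMatrix_eq`). Conversely every matrix of this shape preserves the relation
(`digon_relation`), hence defines an endomorphism, and the inverse of an invertible one has the same
shape. -/

namespace LayeredGraph

/-! ### Path elements and homomorphisms out of `A(Γ)`. -/

section Lift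

variable {k : Type*} [Field k] {Γ : LayeredGraph}

lemma pathElem_zero (π : List Γ.E) : pathElem k Γ π 0 = 1 := by
  simp [pathElem]

lemma pathElem_nil_succ (m : ℕ) : pathElem k Γ [] (m + 1) = 0 := by
  simp [pathElem]

/-- The subsequences either omit the first edge or start with it. -/
lemma pathElem_cons_succ (e : Γ.E) (π : List Γ.E) (m : ℕ) :
    pathElem k Γ (e :: π) (m + 1) =
      pathElem k Γ π (m + 1) + FreeAlgebra.ι k e * pathElem k Γ π m := by
  simp only [pathElem, List.sublistsLen_succ_cons, List.map_append, List.sum_append,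
    List.map_map, Function.comp_def, List.map_cons, List.prod_cons, List.sum_map_mul_left]

lemma pathElem_of_length_lt {π : List Γ.E} {m : ℕ} (h : π.length < m) :
    pathElem k Γ π m = 0 := by
  simp [pathElem, List.sublistsLen_of_length_lt h]

lemma IsPath.level_eq {x y : Γ.V} {π : List Γ.E} (h : Γ.IsPath x π y) :
    Γ.level x = Γ.level y + π.length := by
  induction π generalizing x with
  | nil => cases h; rfl
  | cons e π ih =>
    obtain ⟨rfl, h⟩ := h
    rw [Γ.level_tail, ih h, List.length_cons]; omega

/-- The bounds on `m` in the relations are harmless: levels force both paths to have the same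
length, beyond which both elements vanish, and for `m = 0` both are `1`. -/
lemma proj_pathElem_eq {x y : Γ.V} {π₁ π₂ : List Γ.E} (h₁ : Γ.IsPath x π₁ y)
    (h₂ : Γ.IsPath x π₂ y) (m : ℕ) :
    proj k Γ (pathElem k Γ π₁ m) = proj k Γ (pathElem k Γ π₂ m) := by
  have hl : π₁.length = π₂.length := by
    have := h₁.level_eq; have := h₂.level_eq; omega
  rcases Nat.eq_zero_or_pos m with rfl | hm
  · simp only [pathElem_zero]
  rcases lt_or_ge π₁.length m with hm' | hm'
  · rw [pathElem_of_length_lt hm', pathElem_of_length_lt (hl ▸ hm')]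
  · exact RingQuot.mkAlgHom_rel k (Rel.mk x y π₁ π₂ h₁ h₂ m hm hm')

/-- The homomorphism out of `A(Γ)` with prescribed values on the edges. -/
noncomputable def liftAlg {B : Type*} [Ring B] [Algebra k B] (f : Γ.E → B)
    (h : ∀ x y π₁ π₂, Γ.IsPath x π₁ y → Γ.IsPath x π₂ y → ∀ m,
      FreeAlgebra.lift k f (pathElem k Γ π₁ m) = FreeAlgebra.lift k f (pathElem k Γ π₂ m)) :
    Alg k Γ →ₐ[k] B :=
  RingQuot.liftAlgHom k ⟨FreeAlgebra.lift k f, by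
    rintro _ _ ⟨x, y, π₁, π₂, h₁, h₂, m, -, -⟩
    exact h x y π₁ π₂ h₁ h₂ m⟩

@[simp]
lemma liftAlg_edge {B : Type*} [Ring B] [Algebra k B] (f : Γ.E → B) (h) (e : Γ.E) :
    liftAlg (k := k) f h (edge k Γ e) = f e := by
  simp [liftAlg, edge, proj]

lemma algHom_ext {B : Type*} [Semiring B] [Algebra k B] {f g : Alg k Γ →ₐ[k] B}
    (h : ∀ e, f (edge k Γ e) = g (edge k Γ e)) : f = g := by
  apply RingQuot.ringQuot_ext'
  apply FreeAlgebra.hom_ext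
  funext e
  exact h e

lemma algEquiv_ext {σ τ : Alg k Γ ≃ₐ[k] Alg k Γ}
    (h : ∀ e, σ (edge k Γ e) = τ (edge k Γ e)) : σ = τ := by
  have : (σ : Alg k Γ →ₐ[k] Alg k Γ) = τ := algHom_ext h
  ext a
  exact DFunLike.congr_fun this a

variable {B : Type*} [Ring B] [Algebra k B]

/-- The sum of the edge values telescopes. -/
lemma lift_pathElem_one {f : Γ.E → B} {g : Γ.V → B}
    (hg : ∀ e, f e = g (Γ.tail e) - g (Γ.head e)) {x y : Γ.V} {π : List Γ.E}
    (h : Γ.IsPath x π y) : FreeAlgebra.lift k f (pathElem k Γ π 1) = g x - g y := by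
  induction π generalizing x with
  | nil => cases h; simp [pathElem_nil_succ]
  | cons e π ih =>
    obtain ⟨rfl, h⟩ := h
    rw [pathElem_cons_succ, map_add, ih h, pathElem_zero, mul_one, FreeAlgebra.lift_ι_apply, hg]
    abel

/-- Think of `φ x` as the value of `e(π, 2)` on a path from `x` to `star`. Concatenation gives
`e(ππ', 2) = e(π, 2) + e(π, 1) e(π', 1) + e(π', 2)`, and solving for `e(π, 2)` leaves an expression
in the end points alone. -/
lemma lift_pathElem_two {f : Γ.E → B} {g φ : Γ.V → B}
    (hg : ∀ e, f e = g (Γ.tail e) - g (Γ.head e))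
    (hφ : ∀ e, φ (Γ.tail e) = f e * g (Γ.head e) + φ (Γ.head e)) {x y : Γ.V} {π : List Γ.E}
    (h : Γ.IsPath x π y) :
    FreeAlgebra.lift k f (pathElem k Γ π 2) = φ x - φ y - (g x - g y) * g y := by
  induction π generalizing x with
  | nil => cases h; simp [pathElem_nil_succ]
  | cons e π ih =>
    obtain ⟨rfl, h⟩ := h
    rw [pathElem_cons_succ, map_add, ih h, map_mul, lift_pathElem_one hg h,
      FreeAlgebra.lift_ι_apply, hφ, hg]
    noncomm_ring

/-- If the values of `f` on the edges are differences of vertex values, are compatible with the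
quadratic relations, and kill the terms `e(π, m)` with `m ≥ 3`, then they respect the
relations of `A(Γ)`. -/
lemma lift_pathElem_eq {f : Γ.E → B} {g φ : Γ.V → B}
    (hg : ∀ e, f e = g (Γ.tail e) - g (Γ.head e))
    (hφ : ∀ e, φ (Γ.tail e) = f e * g (Γ.head e) + φ (Γ.head e))
    (h₃ : ∀ x y π, Γ.IsPath x π y → ∀ m, FreeAlgebra.lift k f (pathElem k Γ π (m + 3)) = 0)
    (x y : Γ.V) (π₁ π₂ : List Γ.E) (h₁ : Γ.IsPath x π₁ y) (h₂ : Γ.IsPath x π₂ y) (m : ℕ) :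
    FreeAlgebra.lift k f (pathElem k Γ π₁ m) = FreeAlgebra.lift k f (pathElem k Γ π₂ m) := by
  match m with
  | 0 => simp only [pathElem_zero]
  | 1 => rw [lift_pathElem_one hg h₁, lift_pathElem_one hg h₂]
  | 2 => rw [lift_pathElem_two hg hφ h₁, lift_pathElem_two hg hφ h₂]
  | m + 3 => rw [h₃ x y π₁ h₁, h₃ x y π₂ h₂]

end Lift

/-! ### Vertex generators, grading and filtration. -/

section Generators

variable (k : Type*) [Field k] (Γ : LayeredGraph)

lemma exists_isPath_star (x : Γ.V) : ∃ π, Γ.IsPath x π Γ.star := by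
  induction hn : Γ.level x generalizing x with
  | zero => exact ⟨[], (Γ.level_eq_zero_iff x).1 hn⟩
  | succ n ih =>
    have hx : x ≠ Γ.star := fun h => by
      rw [(Γ.level_eq_zero_iff x).2 h] at hn; omega
    obtain ⟨e, rfl⟩ := Γ.exists_edge x hx
    obtain ⟨π, hπ⟩ := ih (Γ.head e) (by have := Γ.level_tail e; omega)
    exact ⟨e :: π, rfl, hπ⟩

/-- The generator of `A(Γ)` attached to a vertex: the class of `e(π, 1)` for any path `π` from
this vertex to `star`. -/
noncomputable def gen (x : Γ.V) : Alg k Γ :=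
  proj k Γ (pathElem k Γ (Γ.exists_isPath_star x).choose 1)

variable {Γ}

lemma proj_pathElem_one {x : Γ.V} {π : List Γ.E} (h : Γ.IsPath x π Γ.star) :
    proj k Γ (pathElem k Γ π 1) = gen k Γ x :=
  proj_pathElem_eq h (Γ.exists_isPath_star x).choose_spec 1

variable (Γ) in
@[simp]
lemma gen_star : gen k Γ Γ.star = 0 := by
  rw [← proj_pathElem_one k (show Γ.IsPath Γ.star [] Γ.star from rfl), pathElem_nil_succ, map_zero]

lemma edge_eq_gen_sub (e : Γ.E) :
    edge k Γ e = gen k Γ (Γ.tail e) - gen k Γ (Γ.head e) := by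
  obtain ⟨π, hπ⟩ := Γ.exists_isPath_star (Γ.head e)
  rw [← proj_pathElem_one k hπ,
    ← proj_pathElem_one k (show Γ.IsPath (Γ.tail e) (e :: π) Γ.star from ⟨rfl, hπ⟩),
    pathElem_cons_succ, pathElem_zero, mul_one, map_add, add_sub_cancel_left, edge]

/-- The quadratic relation attached to two paths of length two with the same end points. -/
lemma edge_mul_edge_eq {a b c d : Γ.E} (h₁ : Γ.tail a = Γ.tail c) (h₂ : Γ.head a = Γ.tail b)
    (h₃ : Γ.head c = Γ.tail d) (h₄ : Γ.head b = Γ.head d) :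
    edge k Γ a * edge k Γ b = edge k Γ c * edge k Γ d := by
  have := proj_pathElem_eq (k := k) (show Γ.IsPath (Γ.tail a) [a, b] (Γ.head b) from
    ⟨rfl, h₂.symm, rfl⟩) (show Γ.IsPath (Γ.tail a) [c, d] (Γ.head b) from
    ⟨h₁.symm, h₃.symm, h₄.symm⟩) 2
  simpa [pathElem_cons_succ, pathElem_nil_succ, pathElem_zero, edge] using this

lemma edge_mem_component (e : Γ.E) : edge k Γ e ∈ component k Γ 1 :=
  Submodule.subset_span ⟨[e], rfl, by simp⟩

lemma gen_mem_component (x : Γ.V) : gen k Γ x ∈ component k Γ 1 := by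
  induction hn : Γ.level x generalizing x with
  | zero => rw [(Γ.level_eq_zero_iff x).1 hn, gen_star]; exact zero_mem _
  | succ n ih =>
    have hx : x ≠ Γ.star := fun h => by
      rw [(Γ.level_eq_zero_iff x).2 h] at hn; omega
    obtain ⟨e, rfl⟩ := Γ.exists_edge x hx
    have := ih (Γ.head e) (by have := Γ.level_tail e; omega)
    rw [← sub_add_cancel (gen k Γ (Γ.tail e)) (gen k Γ (Γ.head e)), ← edge_eq_gen_sub]
    exact add_mem (edge_mem_component k e) this

lemma filtration_mono {i j : ℕ} (h : i ≤ j) : filtration k Γ i ≤ filtration k Γ j :=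
  Submodule.span_mono fun _ ⟨l, hl, ha⟩ => ⟨l, hl.trans h, ha⟩

lemma edge_mem_filtration (e : Γ.E) : edge k Γ e ∈ filtration k Γ (Γ.level (Γ.tail e)) :=
  Submodule.subset_span ⟨[e], by simp, by simp⟩

lemma gen_mem_filtration (x : Γ.V) : gen k Γ x ∈ filtration k Γ (Γ.level x) := by
  induction hn : Γ.level x generalizing x with
  | zero => rw [(Γ.level_eq_zero_iff x).1 hn, gen_star]; exact zero_mem _
  | succ n ih =>
    have hx : x ≠ Γ.star := fun h => by
      rw [(Γ.level_eq_zero_iff x).2 h] at hn; omega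
    obtain ⟨e, rfl⟩ := Γ.exists_edge x hx
    have := ih (Γ.head e) (by have := Γ.level_tail e; omega)
    rw [← sub_add_cancel (gen k Γ (Γ.tail e)) (gen k Γ (Γ.head e)), ← edge_eq_gen_sub, ← hn]
    exact add_mem (edge_mem_filtration k e) (filtration_mono k (by omega) this)

variable {k}

/-- An automorphism is determined by its values on the vertex generators. -/
lemma autAlg_ext {σ τ : autAlg k Γ} (h : ∀ x, σ.1 (gen k Γ x) = τ.1 (gen k Γ x)) : σ = τ :=
  Subtype.ext <| algEquiv_ext fun e => by
    rw [edge_eq_gen_sub, map_sub, map_sub, h, h]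

lemma component_mul {i j : ℕ} {a b : Alg k Γ} (ha : a ∈ component k Γ i)
    (hb : b ∈ component k Γ j) : a * b ∈ component k Γ (i + j) := by
  have h : component k Γ i * component k Γ j ≤ component k Γ (i + j) := by
    rw [component, component, Submodule.span_mul_span]
    refine Submodule.span_mono ?_
    rintro _ ⟨_, ⟨l, hl, rfl⟩, _, ⟨l', hl', rfl⟩, rfl⟩
    exact ⟨l ++ l', by simp [hl, hl'], by simp⟩
  exact h (Submodule.mul_mem_mul ha hb)

lemma filtration_mul {i j : ℕ} {a b : Alg k Γ} (ha : a ∈ filtration k Γ i)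
    (hb : b ∈ filtration k Γ j) : a * b ∈ filtration k Γ (i + j) := by
  have h : filtration k Γ i * filtration k Γ j ≤ filtration k Γ (i + j) := by
    rw [filtration, filtration, Submodule.span_mul_span]
    refine Submodule.span_mono ?_
    rintro _ ⟨_, ⟨l, hl, rfl⟩, _, ⟨l', hl', rfl⟩, rfl⟩
    exact ⟨l ++ l', by simpa using add_le_add hl hl', by simp⟩
  exact h (Submodule.mul_mem_mul ha hb)

lemma map_component_le {f : Alg k Γ →ₐ[k] Alg k Γ}
    (h : ∀ e, f (edge k Γ e) ∈ component k Γ 1) {i : ℕ} {a : Alg k Γ}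
    (ha : a ∈ component k Γ i) : f a ∈ component k Γ i := by
  suffices component k Γ i ≤ (component k Γ i).comap f.toLinearMap from this ha
  refine Submodule.span_le.2 ?_
  rintro _ ⟨l, rfl, rfl⟩
  simp only [Submodule.comap_coe, Set.mem_preimage, AlgHom.toLinearMap_apply, SetLike.mem_coe]
  clear ha
  induction l with
  | nil => exact Submodule.subset_span ⟨[], rfl, by simp⟩
  | cons e l ih =>
    rw [List.map_cons, List.prod_cons, map_mul, List.length_cons, add_comm]
    exact component_mul (h e) ih

lemma map_filtration_le {f : Alg k Γ →ₐ[k] Alg k Γ}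
    (h : ∀ e, f (edge k Γ e) ∈ filtration k Γ (Γ.level (Γ.tail e))) {i : ℕ} {a : Alg k Γ}
    (ha : a ∈ filtration k Γ i) : f a ∈ filtration k Γ i := by
  suffices filtration k Γ i ≤ (filtration k Γ i).comap f.toLinearMap from this ha
  refine Submodule.span_le.2 ?_
  rintro _ ⟨l, hl, rfl⟩
  refine filtration_mono k hl ?_
  clear hl
  simp only [AlgHom.toLinearMap_apply]
  induction l with
  | nil => exact Submodule.subset_span ⟨[], by simp, by simp⟩
  | cons e l ih =>
    simp only [List.map_cons, List.prod_cons, map_mul, List.sum_cons]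
    exact filtration_mul (h e) ih

/-- An algebra automorphism which, together with its inverse, maps the edges into the right pieces
of the grading and of the filtration, belongs to `Aut(A(Γ))`. -/
lemma mem_autAlg {σ : Alg k Γ ≃ₐ[k] Alg k Γ}
    (h : ∀ e, σ (edge k Γ e) ∈ component k Γ 1 ∧
      σ (edge k Γ e) ∈ filtration k Γ (Γ.level (Γ.tail e)))
    (h' : ∀ e, σ.symm (edge k Γ e) ∈ component k Γ 1 ∧
      σ.symm (edge k Γ e) ∈ filtration k Γ (Γ.level (Γ.tail e))) :
    σ ∈ autAlg k Γ := by
  intro i a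
  refine ⟨⟨fun ha => ?_, fun ha => ?_⟩, ⟨fun ha => ?_, fun ha => ?_⟩⟩
  · simpa using map_component_le (f := σ.symm) (fun e => (h' e).1) ha
  · exact map_component_le (f := σ) (fun e => (h e).1) ha
  · simpa using map_filtration_le (f := σ.symm) (fun e => (h' e).2) ha
  · exact map_filtration_le (f := σ) (fun e => (h e).2) ha

end Generators

/-! ### Detecting degrees one and two by bilinear forms. -/

section Truncation

variable {k : Type*} [Field k]

section Operators

variable {X : Type*} [AddCommGroup X] [Module k X] (β : X →ₗ[k] X →ₗ[k] k)

/-- Multiplication by `x` in the algebra `k × X × k` with product `β` on `X`. -/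
def mulOp : X →ₗ[k] Module.End k (k × X × k) where
  toFun x :=
    { toFun := fun p => (0, p.1 • x, β x p.2.1)
      map_add' := fun p q => by simp [add_smul]
      map_smul' := fun c p => by simp [mul_smul] }
  map_add' x y := by ext <;> simp
  map_smul' c x := by ext <;> simp

/-- Multiplication by `c` in the last summand in the algebra `k × X × k`. -/
def topOp (X : Type*) [AddCommGroup X] [Module k X] : k →ₗ[k] Module.End k (k × X × k) where
  toFun c :=
    { toFun := fun p => (0, 0, c * p.1)
      map_add' := fun p q => by simp [mul_add]
      map_smul' := fun d p => by simp [mul_left_comm] }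
  map_add' x y := by ext <;> simp
  map_smul' c x := by ext <;> simp

lemma mulOp_apply (x : X) (p : k × X × k) : mulOp β x p = (0, p.1 • x, β x p.2.1) := rfl

lemma topOp_apply (c : k) (p : k × X × k) : topOp X c p = (0, 0, c * p.1) := rfl

lemma mulOp_mul_mulOp (x y : X) : mulOp β x * mulOp β y = topOp X (β x y) := by
  refine LinearMap.ext fun p => ?_
  simp [mulOp_apply, topOp_apply, mul_comm]

lemma mulOp_mul_topOp (x : X) (c : k) : mulOp β x * topOp X c = 0 := by
  refine LinearMap.ext fun p => ?_
  simp [mulOp_apply, topOp_apply]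

variable {Γ : LayeredGraph}

/-- Two factors land in the last summand and a third kills it. The two claims are proved together
because `e(π, m + 3)` of a longer path involves `e(π, m + 2)` of the shorter one. -/
lemma lift_mulOp_pathElem (f : Γ.E → X) (π : List Γ.E) (m : ℕ) :
    (∃ c, FreeAlgebra.lift k (fun e => mulOp β (f e)) (pathElem k Γ π (m + 2)) = topOp X c) ∧
      FreeAlgebra.lift k (fun e => mulOp β (f e)) (pathElem k Γ π (m + 3)) = 0 := by
  have h₁ : ∃ x, FreeAlgebra.lift k (fun e => mulOp β (f e)) (pathElem k Γ π 1) = mulOp β x := by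
    induction π with
    | nil => exact ⟨0, by simp [pathElem_nil_succ]⟩
    | cons e π ih =>
      obtain ⟨x, hx⟩ := ih
      exact ⟨x + f e, by simp [pathElem_cons_succ, pathElem_zero, hx]⟩
  induction π generalizing m with
  | nil => exact ⟨⟨0, by simp [pathElem_nil_succ]⟩, by simp [pathElem_nil_succ]⟩
  | cons e π ih =>
    have h₁' : ∃ x, FreeAlgebra.lift k (fun e => mulOp β (f e)) (pathElem k Γ π 1) =
        mulOp β x := by
      obtain ⟨x, hx⟩ := h₁
      refine ⟨x - f e, ?_⟩
      rw [map_sub, ← hx]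
      simp [pathElem_cons_succ, pathElem_zero]
    replace ih := fun m => ih m h₁'
    constructor
    · obtain ⟨c, hc⟩ := (ih m).1
      match m with
      | 0 =>
        obtain ⟨x, hx⟩ := h₁'
        refine ⟨c + β (f e) x, ?_⟩
        rw [pathElem_cons_succ, map_add, hc, map_mul, hx, FreeAlgebra.lift_ι_apply,
          mulOp_mul_mulOp, map_add]
      | m + 1 =>
        obtain ⟨d, hd⟩ := (ih m).1
        refine ⟨c, ?_⟩
        rw [pathElem_cons_succ, map_add, hc, map_mul, hd, FreeAlgebra.lift_ι_apply,
          mulOp_mul_topOp, add_zero]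
    · obtain ⟨c, hc⟩ := (ih m).1
      rw [pathElem_cons_succ, map_add, (ih m).2, map_mul, hc, FreeAlgebra.lift_ι_apply,
        mulOp_mul_topOp, add_zero]

end Operators

variable {Γ : LayeredGraph}

open Classical in
/-- The basis vector attached to a vertex, and `0` for `star`. -/
noncomputable def vec (k : Type*) [Field k] (Γ : LayeredGraph) (x : Γ.V) : Γ.V → k :=
  fun y => if y = x ∧ x ≠ Γ.star then 1 else 0

lemma vec_star : vec k Γ Γ.star = 0 := by
  funext y; simp [vec]

/-- A bilinear form `β` on the degree-one part of `A(Γ)` is admissible if it has a potential, which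
makes it vanish on the quadratic relations. -/
def Admissible (β : (Γ.V → k) →ₗ[k] (Γ.V → k) →ₗ[k] k) : Prop :=
  ∃ φ : Γ.V → k, ∀ e, φ (Γ.tail e) =
    β (vec k Γ (Γ.tail e) - vec k Γ (Γ.head e)) (vec k Γ (Γ.head e)) + φ (Γ.head e)

variable {β : (Γ.V → k) →ₗ[k] (Γ.V → k) →ₗ[k] k}

/-- The representation of `A(Γ)` on `k × X × k` defined by an admissible form `β` on `X`. -/
noncomputable def truncRep (hβ : Admissible β) :
    Alg k Γ →ₐ[k] Module.End k (k × (Γ.V → k) × k) :=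
  liftAlg (fun e => mulOp β (vec k Γ (Γ.tail e) - vec k Γ (Γ.head e))) <|
    lift_pathElem_eq (g := fun x => mulOp β (vec k Γ x)) (φ := fun x => topOp _ (hβ.choose x))
      (fun e => map_sub _ _ _)
      (fun e => by rw [mulOp_mul_mulOp, ← map_add, ← hβ.choose_spec e])
      (fun _ _ π _ m => (lift_mulOp_pathElem β _ π m).2)

lemma truncRep_edge (hβ : Admissible β) (e : Γ.E) :
    truncRep hβ (edge k Γ e) = mulOp β (vec k Γ (Γ.tail e) - vec k Γ (Γ.head e)) := by
  simp [truncRep]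

/-- The degree-one coordinates of an element of `A(Γ)`. -/
noncomputable def coordOf (hβ : Admissible β) : Alg k Γ →ₗ[k] Γ.V → k where
  toFun a := (truncRep hβ a (1, 0, 0)).2.1
  map_add' a b := by simp
  map_smul' c a := by simp

/-- The value of the form `β` on the degree-two part of an element of `A(Γ)`. -/
noncomputable def formOf (hβ : Admissible β) : Alg k Γ →ₗ[k] k where
  toFun a := (truncRep hβ a (1, 0, 0)).2.2
  map_add' a b := by simp
  map_smul' c a := by simp

lemma coordOf_edge (hβ : Admissible β) (e : Γ.E) :
    coordOf hβ (edge k Γ e) = vec k Γ (Γ.tail e) - vec k Γ (Γ.head e) := by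
  simp [coordOf, truncRep_edge, mulOp_apply]

/-- A degree-one element acts as `mulOp`, whose last component only sees the middle component of its
argument. Hence `b` enters through its degree-one coordinates alone, whatever its other degrees. -/
lemma formOf_mul_of_mem (hβ : Admissible β) {a b : Alg k Γ} (ha : a ∈ component k Γ 1) :
    formOf hβ (a * b) = β (coordOf hβ a) (coordOf hβ b) := by
  induction ha using Submodule.span_induction with
  | mem a ha =>
    obtain ⟨l, hl, rfl⟩ := ha
    obtain ⟨e, rfl⟩ := List.length_eq_one_iff.1 hl
    simp only [List.map_cons, List.map_nil, List.prod_cons, List.prod_nil, mul_one, coordOf_edge]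
    simp [formOf, truncRep_edge, mulOp_apply, coordOf]
  | zero => simp
  | add a c _ _ ha hc => rw [add_mul, map_add, ha, hc]; simp
  | smul c a _ ha => rw [smul_mul_assoc, map_smul, ha]; simp

variable (k Γ) in
lemma admissible_zero : Admissible (0 : (Γ.V → k) →ₗ[k] (Γ.V → k) →ₗ[k] k) :=
  ⟨0, fun e => by simp⟩

variable (k Γ) in
/-- The degree-one coordinates of an element of `A(Γ)`. -/
noncomputable def coord : Alg k Γ →ₗ[k] Γ.V → k := coordOf (admissible_zero k Γ)

@[simp]
lemma coord_edge (e : Γ.E) :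
    coord k Γ (edge k Γ e) = vec k Γ (Γ.tail e) - vec k Γ (Γ.head e) :=
  coordOf_edge _ e

/-- The form `β` affects only the last component, so the coordinates may be computed with `β = 0`.
-/
lemma coordOf_eq_coord (hβ : Admissible β) {a : Alg k Γ} (ha : a ∈ component k Γ 1) :
    coordOf hβ a = coord k Γ a := by
  induction ha using Submodule.span_induction with
  | mem a ha =>
    obtain ⟨l, hl, rfl⟩ := ha
    obtain ⟨e, rfl⟩ := List.length_eq_one_iff.1 hl
    simp [coordOf_edge]
  | zero => simp
  | add a c _ _ ha hc => rw [map_add, map_add, ha, hc]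
  | smul c a _ ha => rw [map_smul, map_smul, ha]

lemma formOf_mul (hβ : Admissible β) {a b : Alg k Γ} (ha : a ∈ component k Γ 1)
    (hb : b ∈ component k Γ 1) : formOf hβ (a * b) = β (coord k Γ a) (coord k Γ b) := by
  rw [formOf_mul_of_mem hβ ha, coordOf_eq_coord hβ ha, coordOf_eq_coord hβ hb]

-- This gives the linear independence of the generators of the vertices other than `star`;
-- `eq_sum_coord` shows that they span degree one.
@[simp]
lemma coord_gen (x : Γ.V) : coord k Γ (gen k Γ x) = vec k Γ x := by
  induction hn : Γ.level x generalizing x with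
  | zero => rw [(Γ.level_eq_zero_iff x).1 hn, gen_star, map_zero, vec_star]
  | succ n ih =>
    have hx : x ≠ Γ.star := fun h => by
      rw [(Γ.level_eq_zero_iff x).2 h] at hn; omega
    obtain ⟨e, rfl⟩ := Γ.exists_edge x hx
    have := ih (Γ.head e) (by have := Γ.level_tail e; omega)
    rw [← sub_add_cancel (gen k Γ (Γ.tail e)) (gen k Γ (Γ.head e)), ← edge_eq_gen_sub, map_add,
      this, coord_edge, sub_add_cancel]

lemma sum_vec_smul_gen [Fintype Γ.V] (x : Γ.V) : ∑ b, vec k Γ x b • gen k Γ b = gen k Γ x := by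
  classical
  by_cases hx : x = Γ.star
  · simp [hx, vec_star]
  · simp [vec, hx]

lemma eq_sum_coord [Fintype Γ.V] {a : Alg k Γ} (ha : a ∈ component k Γ 1) :
    a = ∑ b, coord k Γ a b • gen k Γ b := by
  induction ha using Submodule.span_induction with
  | mem a ha =>
    obtain ⟨l, hl, rfl⟩ := ha
    obtain ⟨e, rfl⟩ := List.length_eq_one_iff.1 hl
    have (b : Γ.V) : coord k Γ (edge k Γ e) b • gen k Γ b =
        vec k Γ (Γ.tail e) b • gen k Γ b - vec k Γ (Γ.head e) b • gen k Γ b := by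
      rw [coord_edge]
      exact sub_smul (vec k Γ (Γ.tail e) b) (vec k Γ (Γ.head e) b) (gen k Γ b)
    simp only [List.map_cons, List.map_nil, List.prod_singleton, this,
      Finset.sum_sub_distrib, sum_vec_smul_gen]
    exact edge_eq_gen_sub k e
  | zero => simp
  | add a c _ _ ha hc =>
    simp only [map_add, Pi.add_apply, add_smul, Finset.sum_add_distrib]
    rw [← ha, ← hc]
  | smul c a _ ha =>
    simp only [map_smul, Pi.smul_apply, smul_assoc, ← Finset.smul_sum]
    rw [← ha]

lemma coord_star {a : Alg k Γ} (ha : a ∈ component k Γ 1) : coord k Γ a Γ.star = 0 := by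
  induction ha using Submodule.span_induction with
  | mem a ha =>
    obtain ⟨l, hl, rfl⟩ := ha
    obtain ⟨e, rfl⟩ := List.length_eq_one_iff.1 hl
    simp +contextual [vec, eq_comm]
  | zero => simp
  | add a c _ _ ha hc => simp [ha, hc]
  | smul c a _ ha => simp [ha]

/-- Only the one-edge products contribute in degree one, and an edge involves no vertex above its
tail. -/
lemma coord_of_mem_filtration {i : ℕ} {a : Alg k Γ} (ha : a ∈ filtration k Γ i) {b : Γ.V}
    (hb : i < Γ.level b) : coord k Γ a b = 0 := by
  induction ha using Submodule.span_induction with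
  | mem a ha =>
    obtain ⟨l, hl, rfl⟩ := ha
    match l with
    | [] => simp [coord, coordOf]
    | [e] =>
      have := Γ.level_tail e
      have h₁ : b ≠ Γ.tail e := by rintro rfl; simp at hl; omega
      have h₂ : b ≠ Γ.head e := by rintro rfl; simp at hl; omega
      simp [vec, h₁, h₂]
    | e :: e' :: l => simp [coord, coordOf, truncRep_edge, mulOp_apply]
  | zero => simp
  | add a c _ _ ha hc => simp [ha, hc]
  | smul c a _ ha => simp [ha]

end Truncation

/-! ### Coordinates of automorphisms and the equations they satisfy. -/

section Automorphisms

variable {k : Type*} [Field k] {Γ : LayeredGraph}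

/-- The coordinates of the image of a vertex generator under an automorphism of `A(Γ)`. -/
noncomputable def autCoord (σ : autAlg k Γ) (x : Γ.V) : Γ.V → k :=
  coord k Γ (σ.1 (gen k Γ x))

lemma aut_mem_component (σ : autAlg k Γ) {a : Alg k Γ} (ha : a ∈ component k Γ 1) :
    σ.1 a ∈ component k Γ 1 :=
  (σ.2 1 a).1.2 ha

lemma autCoord_of_lt (σ : autAlg k Γ) {x y : Γ.V} (h : Γ.level x < Γ.level y) :
    autCoord σ x y = 0 :=
  coord_of_mem_filtration ((σ.2 _ _).2.2 (gen_mem_filtration k x)) h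

lemma autCoord_star_right (σ : autAlg k Γ) (x : Γ.V) : autCoord σ x Γ.star = 0 :=
  coord_star (aut_mem_component σ (gen_mem_component k x))

lemma autCoord_star_left (σ : autAlg k Γ) : autCoord σ Γ.star = 0 := by
  simp [autCoord]

lemma aut_gen [Fintype Γ.V] (σ : autAlg k Γ) (x : Γ.V) :
    σ.1 (gen k Γ x) = ∑ y, autCoord σ x y • gen k Γ y :=
  eq_sum_coord (aut_mem_component σ (gen_mem_component k x))

lemma autCoord_mul [Fintype Γ.V] (σ τ : autAlg k Γ) (x : Γ.V) :
    autCoord (σ * τ) x = ∑ y, autCoord τ x y • autCoord σ y := by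
  rw [autCoord, show (σ * τ).1 (gen k Γ x) = σ.1 (τ.1 (gen k Γ x)) from rfl, aut_gen τ]
  simp [autCoord]

lemma autCoord_one (x : Γ.V) : autCoord (1 : autAlg k Γ) x = vec k Γ x :=
  coord_gen x

lemma autCoord_ext [Fintype Γ.V] {σ τ : autAlg k Γ} (h : ∀ x, autCoord σ x = autCoord τ x) :
    σ = τ :=
  autAlg_ext fun x => by rw [aut_gen, aut_gen, h]

/-- The equation obtained by evaluating an admissible form on the image of a quadratic relation
under an automorphism. -/
lemma form_autCoord_eq {β : (Γ.V → k) →ₗ[k] (Γ.V → k) →ₗ[k] k} (hβ : Admissible β)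
    (σ : autAlg k Γ) {a b c d : Γ.E} (h₁ : Γ.tail a = Γ.tail c) (h₂ : Γ.head a = Γ.tail b)
    (h₃ : Γ.head c = Γ.tail d) (h₄ : Γ.head b = Γ.head d) :
    β (autCoord σ (Γ.tail a) - autCoord σ (Γ.head a))
        (autCoord σ (Γ.tail b) - autCoord σ (Γ.head b)) =
      β (autCoord σ (Γ.tail c) - autCoord σ (Γ.head c))
        (autCoord σ (Γ.tail d) - autCoord σ (Γ.head d)) := by
  have key (e : Γ.E) : autCoord σ (Γ.tail e) - autCoord σ (Γ.head e) =
      coord k Γ (σ.1 (edge k Γ e)) := by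
    simp [autCoord, edge_eq_gen_sub]
  have hm (e : Γ.E) := aut_mem_component σ (edge_mem_component k e)
  rw [key, key, key, key, ← formOf_mul hβ (hm a) (hm b), ← formOf_mul hβ (hm c) (hm d), ← map_mul,
    ← map_mul, edge_mul_edge_eq k h₁ h₂ h₃ h₄]

end Automorphisms

/-! ### Scalars and graph automorphisms acting on `A(Γ)`. -/

section GraphAutomorphisms

variable {k : Type*} [Field k] {Γ : LayeredGraph}

/-- `star` is the only vertex that is not a tail: a tail has positive level. -/
lemma autGraph_star (p : Γ.autGraph) : p.1.1 Γ.star = Γ.star := by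
  by_contra h
  obtain ⟨e, he⟩ := Γ.exists_edge _ h
  have h₁ := (p.2 (p.1.2⁻¹ e)).1
  rw [show p.1.2 (p.1.2⁻¹ e) = e from p.1.2.apply_symm_apply e, he] at h₁
  have h₂ := Γ.level_tail (p.1.2⁻¹ e)
  rw [← p.1.1.injective h₁, (Γ.level_eq_zero_iff _).2 rfl] at h₂
  omega

lemma autGraph_level (p : Γ.autGraph) (x : Γ.V) : Γ.level (p.1.1 x) = Γ.level x := by
  induction hn : Γ.level x generalizing x with
  | zero => rw [(Γ.level_eq_zero_iff x).1 hn, autGraph_star, (Γ.level_eq_zero_iff _).2 rfl]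
  | succ n ih =>
    have hx : x ≠ Γ.star := fun h => by
      rw [(Γ.level_eq_zero_iff x).2 h] at hn; omega
    obtain ⟨e, rfl⟩ := Γ.exists_edge x hx
    rw [← (p.2 e).1, Γ.level_tail, (p.2 e).2, ih _ (by have := Γ.level_tail e; omega)]

lemma IsPath.map (p : Γ.autGraph) {x y : Γ.V} {π : List Γ.E} (h : Γ.IsPath x π y) :
    Γ.IsPath (p.1.1 x) (π.map p.1.2) (p.1.1 y) := by
  induction π generalizing x with
  | nil => exact congrArg p.1.1 h
  | cons e π ih =>
    obtain ⟨rfl, h⟩ := h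
    exact ⟨(p.2 e).1, (p.2 e).2 ▸ ih h⟩

/-- `e(π, m)` is homogeneous of degree `m`, so the scalar comes out as `α ^ m`. -/
lemma lift_smul_pathElem (α : k) (f : Γ.E → Γ.E) (π : List Γ.E) (m : ℕ) :
    FreeAlgebra.lift k (fun e => α • edge k Γ (f e)) (pathElem k Γ π m) =
      α ^ m • proj k Γ (pathElem k Γ (π.map f) m) := by
  induction π generalizing m with
  | nil => cases m <;> simp [pathElem_zero, pathElem_nil_succ]
  | cons e π ih =>
    cases m with
    | zero => simp [pathElem_zero]
    | succ m =>
      rw [pathElem_cons_succ, map_add, map_mul, ih, ih, List.map_cons, pathElem_cons_succ,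
        map_add, map_mul, FreeAlgebra.lift_ι_apply, smul_add, smul_mul_smul_comm, pow_succ', edge]

/-- The endomorphism `e ↦ α • g e` of `A(Γ)` attached to a scalar and a graph automorphism. -/
noncomputable def scaledHom (α : k) (p : Γ.autGraph) : Alg k Γ →ₐ[k] Alg k Γ :=
  liftAlg (fun e => α • edge k Γ (p.1.2 e)) fun _ _ π₁ π₂ h₁ h₂ m => by
    rw [lift_smul_pathElem, lift_smul_pathElem, proj_pathElem_eq (h₁.map p) (h₂.map p)]

@[simp]
lemma scaledHom_edge (α : k) (p : Γ.autGraph) (e : Γ.E) :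
    scaledHom α p (edge k Γ e) = α • edge k Γ (p.1.2 e) :=
  liftAlg_edge _ _ e

/-- The automorphism `e ↦ α • g e` of `A(Γ)` attached to a nonzero scalar and a graph
automorphism. -/
noncomputable def scaledEquiv (α : kˣ) (p : Γ.autGraph) : Alg k Γ ≃ₐ[k] Alg k Γ :=
  AlgEquiv.ofAlgHom (scaledHom (α : k) p) (scaledHom ((α⁻¹ : kˣ) : k) p⁻¹)
    (algHom_ext fun e => by
      simp [smul_smul])
    (algHom_ext fun e => by
      simp [smul_smul])

lemma scaledEquiv_edge (α : kˣ) (p : Γ.autGraph) (e : Γ.E) :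
    scaledEquiv α p (edge k Γ e) = (α : k) • edge k Γ (p.1.2 e) :=
  scaledHom_edge _ _ _

lemma scaledEquiv_symm_edge (α : kˣ) (p : Γ.autGraph) (e : Γ.E) :
    (scaledEquiv α p).symm (edge k Γ e) = ((α⁻¹ : kˣ) : k) • edge k Γ (p⁻¹.1.2 e) :=
  scaledHom_edge _ _ _

lemma smul_edge_mem (c : k) (p : Γ.autGraph) (e : Γ.E) :
    c • edge k Γ (p.1.2 e) ∈ component k Γ 1 ∧
      c • edge k Γ (p.1.2 e) ∈ filtration k Γ (Γ.level (Γ.tail e)) := by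
  refine ⟨Submodule.smul_mem _ _ (edge_mem_component k _), Submodule.smul_mem _ _ ?_⟩
  rw [← autGraph_level p, ← (p.2 e).1]
  exact edge_mem_filtration k _

variable (k Γ) in
/-- The action of `kˣ × Aut(Γ)` on `A(Γ)`. -/
noncomputable def scaledAut : kˣ × Γ.autGraph →* autAlg k Γ where
  toFun p := ⟨scaledEquiv p.1 p.2, mem_autAlg
    (fun e => by rw [scaledEquiv_edge]; exact smul_edge_mem _ _ _)
    (fun e => by rw [scaledEquiv_symm_edge]; exact smul_edge_mem _ _ _)⟩
  map_one' := Subtype.ext <| algEquiv_ext fun e => by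
    simp [scaledEquiv_edge]
  map_mul' p q := Subtype.ext <| algEquiv_ext fun e => by
    simp [scaledEquiv_edge, smul_smul, mul_comm]

lemma scaledAut_edge (p : kˣ × Γ.autGraph) (e : Γ.E) :
    (scaledAut k Γ p).1 (edge k Γ e) = (p.1 : k) • edge k Γ (p.2.1.2 e) :=
  scaledEquiv_edge _ _ _

lemma scaledAut_gen (p : kˣ × Γ.autGraph) (x : Γ.V) :
    (scaledAut k Γ p).1 (gen k Γ x) = (p.1 : k) • gen k Γ (p.2.1.1 x) := by
  induction hn : Γ.level x generalizing x with
  | zero => rw [(Γ.level_eq_zero_iff x).1 hn, autGraph_star, gen_star, map_zero, smul_zero]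
  | succ n ih =>
    have hx : x ≠ Γ.star := fun h => by
      rw [(Γ.level_eq_zero_iff x).2 h] at hn; omega
    obtain ⟨e, rfl⟩ := Γ.exists_edge x hx
    have := ih (Γ.head e) (by have := Γ.level_tail e; omega)
    rw [← sub_add_cancel (gen k Γ (Γ.tail e)) (gen k Γ (Γ.head e)), ← edge_eq_gen_sub, map_add,
      this, scaledAut_edge, ← smul_add, edge_eq_gen_sub, (p.2.2 e).1, (p.2.2 e).2, sub_add_cancel]

end GraphAutomorphisms

end LayeredGraph

open LayeredGraph

/-! ### Adjacency-preserving maps of a cycle. -/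

section ZModCycle

variable {n : ℕ}

lemma ZMod.one_ne_zero_of_three_le (hn : 3 ≤ n) : (1 : ZMod n) ≠ 0 := by
  intro h
  have := (ZMod.natCast_eq_zero_iff 1 n).1 (by simpa using h)
  have := Nat.le_of_dvd (by omega) this
  omega

lemma ZMod.one_add_one_ne_zero_of_three_le (hn : 3 ≤ n) : (1 + 1 : ZMod n) ≠ 0 := by
  intro h
  have := (ZMod.natCast_eq_zero_iff 2 n).1 (by rw [← h]; norm_num)
  have := Nat.le_of_dvd (by omega) this
  omega

/-- A statement about `ZMod n` that is preserved by adding one and holds at zero always holds. -/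
lemma ZMod.induction_add_one [NeZero n] {P : ZMod n → Prop} (h₀ : P 0)
    (h : ∀ i, P i → P (i + 1)) (i : ZMod n) : P i := by
  have key (m : ℕ) : P (m : ZMod n) := by
    induction m with
    | zero => simpa using h₀
    | succ m ih => simpa using h _ ih
  simpa using key i.val

/-- A self-map of the `n`-cycle which is injective and sends neighbours to neighbours is a rotation
or a reflection. -/
lemma ZMod.eq_rotation_or_reflection (hn : 3 ≤ n) {τ : ZMod n → ZMod n}
    (hτ : Function.Injective τ) (h : ∀ i, τ (i + 1) = τ i + 1 ∨ τ i = τ (i + 1) + 1) :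
    ∃ c, (∀ i, τ i = i + c) ∨ (∀ i, τ i = -i - c) := by
  have : NeZero n := ⟨by omega⟩
  -- An injective walk cannot turn back, since `i + 2 ≠ i` for `n ≥ 3`; the direction of the first
  -- step therefore persists.
  have hne (i : ZMod n) : τ (i + 1 + 1) ≠ τ i := fun hi =>
    ZMod.one_add_one_ne_zero_of_three_le hn (by
      have := hτ hi
      rwa [add_assoc, add_eq_left] at this)
  rcases h 0 with h₀ | h₀
  · refine ⟨τ 0, Or.inl ?_⟩
    have step (i : ZMod n) : τ (i + 1) = τ i + 1 := by
      induction i using ZMod.induction_add_one with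
      | h₀ => exact h₀
      | h i ih =>
        refine (h (i + 1)).resolve_right fun hi => hne i ?_
        rw [ih] at hi
        exact (add_right_cancel hi).symm
    intro i
    induction i using ZMod.induction_add_one with
    | h₀ => simp
    | h i ih => rw [step, ih]; ring
  · refine ⟨-τ 0, Or.inr ?_⟩
    have step (i : ZMod n) : τ i = τ (i + 1) + 1 := by
      induction i using ZMod.induction_add_one with
      | h₀ => exact h₀
      | h i ih =>
        refine (h (i + 1)).resolve_left fun hi => hne i ?_
        rw [ih, hi]
    intro i
    induction i using ZMod.induction_add_one with
    | h₀ => simp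
    | h i ih =>
      have := step i
      rw [ih] at this
      linear_combination -this

end ZModCycle

/-! ### The dihedral group as the automorphism group of the polygon graph. -/

section PolygonSymmetries

variable {n : ℕ}

namespace DihedralGroup

/-- The action of the dihedral group on the vertices of the Hasse graph of the `n`-gon. -/
def polygonVertexMap : DihedralGroup n → PolygonVertex n → PolygonVertex n
  | _, .star => .star
  | r i, .w j => .w (j + i)
  | sr i, .w j => .w (-j - i)
  | r i, .v j => .v (j + i)
  | sr i, .v j => .v (-j - i - 1)
  | _, .u => .u

/-- The action of the dihedral group on the edges of the Hasse graph of the `n`-gon. -/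
def polygonEdgeMap : DihedralGroup n → PolygonEdge n → PolygonEdge n
  | r i, .ws j => .ws (j + i)
  | sr i, .ws j => .ws (-j - i)
  | r i, .vw j => .vw (j + i)
  | sr i, .vw j => .vw' (-j - i - 1)
  | r i, .vw' j => .vw' (j + i)
  | sr i, .vw' j => .vw (-j - i - 1)
  | r i, .uv j => .uv (j + i)
  | sr i, .uv j => .uv (-j - i - 1)

instance : MulAction (DihedralGroup n) (PolygonVertex n) where
  smul := polygonVertexMap
  one_smul x := by
    change polygonVertexMap (r 0) x = x
    cases x <;> simp [polygonVertexMap]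
  mul_smul g h x := by
    change polygonVertexMap (g * h) x = polygonVertexMap g (polygonVertexMap h x)
    cases g <;> cases h <;> cases x <;> simp [polygonVertexMap] <;> ring

instance : MulAction (DihedralGroup n) (PolygonEdge n) where
  smul := polygonEdgeMap
  one_smul x := by
    change polygonEdgeMap (r 0) x = x
    cases x <;> simp [polygonEdgeMap]
  mul_smul g h x := by
    change polygonEdgeMap (g * h) x = polygonEdgeMap g (polygonEdgeMap h x)
    cases g <;> cases h <;> cases x <;> simp [polygonEdgeMap] <;> ring

/-- The dihedral group acts on the Hasse graph of the `n`-gon. -/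
def toAutPolygon (n : ℕ) : DihedralGroup n →* (polygonGraph n).autGraph :=
  ((MulAction.toPermHom (DihedralGroup n) (PolygonVertex n)).prod
    (MulAction.toPermHom (DihedralGroup n) (PolygonEdge n))).codRestrict _ <| by
    rintro (i | i) (j | j | j | j)
    all_goals
      constructor
      · rfl
      · first
        | rfl
        | exact congrArg PolygonVertex.w (by ring)

lemma toAutPolygon_r_w (i j : ZMod n) :
    (toAutPolygon n (r i)).1.1 (.w j) = PolygonVertex.w (j + i) := rfl

lemma toAutPolygon_sr_w (i j : ZMod n) :
    (toAutPolygon n (sr i)).1.1 (.w j) = PolygonVertex.w (-j - i) := rfl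

/-- Only the identity of the dihedral group fixes all the corners. -/
lemma eq_one_of_toAutPolygon_w (hn : 3 ≤ n) {g : DihedralGroup n}
    (hg : ∀ j, (toAutPolygon n g).1.1 (.w j) = PolygonVertex.w j) : g = 1 := by
  rcases g with i | i
  · have := hg 0
    rw [toAutPolygon_r_w] at this
    rw [show i = 0 by simpa using PolygonVertex.w.inj this]; rfl
  · have h₀ := hg 0
    have h₁ := hg 1
    rw [toAutPolygon_sr_w] at h₀ h₁
    replace h₀ := PolygonVertex.w.inj h₀
    replace h₁ := PolygonVertex.w.inj h₁
    exact absurd (by linear_combination h₀ - h₁) (ZMod.one_add_one_ne_zero_of_three_le hn)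

/-- Every injective neighbour-preserving map on the corners comes from the dihedral group. -/
lemma exists_toAutPolygon_w (hn : 3 ≤ n) {τ : ZMod n → ZMod n}
    (hτ : Function.Injective τ) (h : ∀ i, τ (i + 1) = τ i + 1 ∨ τ i = τ (i + 1) + 1) :
    ∃ g, ∀ j, (toAutPolygon n g).1.1 (.w j) = PolygonVertex.w (τ j) := by
  obtain ⟨c, hc | hc⟩ := ZMod.eq_rotation_or_reflection hn hτ h
  · exact ⟨r c, fun j => by rw [toAutPolygon_r_w, hc]⟩
  · exact ⟨sr c, fun j => by rw [toAutPolygon_sr_w, hc]⟩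

end DihedralGroup

lemma polygon_edge_ext (hn : 3 ≤ n) {e e' : PolygonEdge n}
    (ht : (polygonGraph n).tail e = (polygonGraph n).tail e')
    (hh : (polygonGraph n).head e = (polygonGraph n).head e') : e = e' := by
  have h1 := ZMod.one_ne_zero_of_three_le hn
  cases e <;> cases e' <;> simp_all [polygonGraph]

/-- An automorphism of the Hasse graph which fixes all the corners is trivial. -/
lemma polygon_autGraph_eq_one (hn : 3 ≤ n) {p : (polygonGraph n).autGraph}
    (hp : ∀ j, p.1.1 (.w j) = PolygonVertex.w j) : p = 1 := by
  have hV (x : PolygonVertex n) : p.1.1 x = x := by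
    cases x with
    | star => exact autGraph_star p
    | w j => exact hp j
    | u =>
      have h := autGraph_level p .u
      rcases hx : p.1.1 .u with _ | j | j | _ <;> rw [hx] at h <;> simp [polygonGraph] at h ⊢
    | v j =>
      have h := autGraph_level p (.v j)
      rcases hx : p.1.1 (.v j) with _ | i | i | _ <;> rw [hx] at h <;> simp [polygonGraph] at h
      have key (e : PolygonEdge n) (he : (polygonGraph n).tail e = .v j) :
          (polygonGraph n).head (p.1.2 e) = p.1.1 ((polygonGraph n).head e) ∧
          ((polygonGraph n).head (p.1.2 e) = .w i ∨
            (polygonGraph n).head (p.1.2 e) = .w (i + 1)) := by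
        refine ⟨(p.2 e).2, ?_⟩
        have := (p.2 e).1
        rw [he, hx] at this
        revert this
        cases p.1.2 e <;> simp +contextual [polygonGraph]
      obtain ⟨h₁, h₂⟩ := key (.vw j) rfl
      obtain ⟨h₃, h₄⟩ := key (.vw' j) rfl
      rw [h₁, show (polygonGraph n).head (.vw j) = .w j from rfl, hp] at h₂
      rw [h₃, show (polygonGraph n).head (.vw' j) = .w (j + 1) from rfl, hp] at h₄
      replace h₂ := h₂.imp PolygonVertex.w.inj PolygonVertex.w.inj
      replace h₄ := h₄.imp PolygonVertex.w.inj PolygonVertex.w.inj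
      -- The image side `v i` contains both corners `j` and `j + 1`. If `j = i + 1`, then `i + 2`
      -- would be `i` or `i + 1`, which `n ≥ 3` excludes.
      rcases h₂ with rfl | rfl
      · rfl
      · rcases h₄ with h₄ | h₄
        · exact absurd (by linear_combination h₄) (ZMod.one_add_one_ne_zero_of_three_le hn)
        · exact absurd (by linear_combination h₄) (ZMod.one_ne_zero_of_three_le hn)
  refine Subtype.ext (Prod.ext (Equiv.ext hV) (Equiv.ext fun e => polygon_edge_ext hn ?_ ?_))
  · exact ((p.2 e).1).trans (hV _)
  · exact ((p.2 e).2).trans (hV _)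

/-- For surjectivity: a side goes to a side, so its two corners go to the two corners of the image
side. The induced map of corners preserves neighbours, hence is dihedral, and the quotient of the
two automorphisms fixes all corners. -/
lemma DihedralGroup.toAutPolygon_bijective (hn : 3 ≤ n) :
    Function.Bijective (DihedralGroup.toAutPolygon n) := by
  constructor
  · refine (injective_iff_map_eq_one _).2 fun g hg => eq_one_of_toAutPolygon_w hn fun j => ?_
    rw [hg]; rfl
  · intro p
    have h1 := ZMod.one_ne_zero_of_three_le hn
    have hw (j : ZMod n) : ∃ i, p.1.1 (.w j) = PolygonVertex.w i := by
      have h := autGraph_level p (.w j)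
      rcases hx : p.1.1 (.w j) with _ | i | i | _ <;> rw [hx] at h <;> simp [polygonGraph] at h ⊢
    have hv (j : ZMod n) : ∃ i, p.1.1 (.v j) = PolygonVertex.v i := by
      have h := autGraph_level p (.v j)
      rcases hx : p.1.1 (.v j) with _ | i | i | _ <;> rw [hx] at h <;> simp [polygonGraph] at h ⊢
    choose τ hτ using hw
    choose π hπ using hv
    have hinj : Function.Injective τ := fun a b hab => by
      have : p.1.1 (.w a) = p.1.1 (.w b) := by rw [hτ, hτ, hab]
      exact PolygonVertex.w.inj (p.1.1.injective this)
    have key (j : ZMod n) (e : PolygonEdge n) (he : (polygonGraph n).tail e = .v j) :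
        p.1.1 ((polygonGraph n).head e) = .w (π j) ∨
          p.1.1 ((polygonGraph n).head e) = .w (π j + 1) := by
      have := (p.2 e).1
      rw [← (p.2 e).2]
      rw [he, hπ] at this
      revert this
      cases p.1.2 e <;> simp +contextual [polygonGraph]
    obtain ⟨g, hg⟩ := exists_toAutPolygon_w hn hinj fun j => by
      have h₁ := key j (.vw j) rfl
      have h₂ := key j (.vw' j) rfl
      rw [show (polygonGraph n).head (.vw j) = .w j from rfl, hτ] at h₁
      rw [show (polygonGraph n).head (.vw' j) = .w (j + 1) from rfl, hτ] at h₂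
      replace h₁ := h₁.imp PolygonVertex.w.inj PolygonVertex.w.inj
      replace h₂ := h₂.imp PolygonVertex.w.inj PolygonVertex.w.inj
      have hne : τ (j + 1) ≠ τ j := fun h => h1 (by simpa using hinj h)
      rcases h₁ with h₁ | h₁ <;> rcases h₂ with h₂ | h₂ <;> simp_all
    refine ⟨g, ?_⟩
    rw [← inv_mul_eq_one]
    refine polygon_autGraph_eq_one hn fun j => ?_
    change (toAutPolygon n g).1.1.symm (p.1.1 (.w j)) = _
    rw [hτ, ← hg]
    exact Equiv.symm_apply_apply _ _

end PolygonSymmetries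

namespace LayeredGraph

/-! ### Top-level parts of the images of generators. -/

section LevelParts

variable {k : Type*} [Field k] {Γ : LayeredGraph}

/-- The bilinear form `(x, y) ↦ x a * y b`. -/
def unitForm (k : Type*) [Field k] {V : Type*} (a b : V) : (V → k) →ₗ[k] (V → k) →ₗ[k] k :=
  (LinearMap.proj a).smulRight (LinearMap.proj b)

@[simp]
lemma unitForm_apply {V : Type*} (a b : V) (x y : V → k) : unitForm k a b x y = x a * y b := by
  simp [unitForm]

/-- Automorphisms reflect the filtration as well as preserve it, so `σ` cannot lower the filtration
degree of a degree-one element. -/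
lemma coord_eq_zero_of_coord_aut [Fintype Γ.V] (σ : autAlg k Γ) {m : ℕ} {a : Alg k Γ}
    (ha : a ∈ component k Γ 1) (h : ∀ y, m < Γ.level y → coord k Γ (σ.1 a) y = 0) {x : Γ.V}
    (hx : m < Γ.level x) : coord k Γ a x = 0 := by
  refine coord_of_mem_filtration ((σ.2 m a).2.1 ?_) hx
  rw [eq_sum_coord (aut_mem_component σ ha)]
  refine Submodule.sum_mem _ fun y _ => ?_
  rcases lt_or_ge m (Γ.level y) with hy | hy
  · rw [h y hy, zero_smul]; exact zero_mem _
  · exact Submodule.smul_mem _ _ (filtration_mono k hy (gen_mem_filtration k y))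

lemma ne_star_of_level_pos {x : Γ.V} (hx : 0 < Γ.level x) : x ≠ Γ.star := fun h => by
  rw [(Γ.level_eq_zero_iff x).2 h] at hx; omega

lemma vec_self {x : Γ.V} (hx : 0 < Γ.level x) : vec k Γ x x = 1 := by
  simp [vec, ne_star_of_level_pos hx]

/-- The level part of the image of a vertex generator does not vanish. -/
lemma exists_autCoord_ne_zero [Fintype Γ.V] (σ : autAlg k Γ) {x : Γ.V} (hx : 0 < Γ.level x) :
    ∃ y, Γ.level y = Γ.level x ∧ autCoord σ x y ≠ 0 := by
  by_contra! h
  have := coord_eq_zero_of_coord_aut σ (m := Γ.level x - 1) (gen_mem_component k x)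
    (fun y hy => by
      rcases (show Γ.level x ≤ Γ.level y by omega).eq_or_lt with h' | h'
      · exact h y h'.symm
      · exact autCoord_of_lt σ h') (x := x) (by omega)
  rw [coord_gen, vec_self hx] at this
  exact one_ne_zero this

/-- Two different vertices of the same level cannot have images whose level parts are proportional
to the same vertex. -/
lemma eq_of_autCoord_support [Fintype Γ.V] (σ : autAlg k Γ) {x x' y₀ : Γ.V}
    (hx : 0 < Γ.level x) (hl : Γ.level x' = Γ.level x)
    (h : ∀ y, Γ.level y = Γ.level x → autCoord σ x y ≠ 0 → y = y₀)
    (h' : ∀ y, Γ.level y = Γ.level x → autCoord σ x' y ≠ 0 → y = y₀) : x = x' := by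
  by_contra hne
  obtain ⟨y, hy, hy'⟩ := exists_autCoord_ne_zero σ (hl.symm ▸ hx : 0 < Γ.level x')
  obtain rfl := h' y (hy.trans hl) hy'
  -- The coefficients are chosen so that the level parts of the images cancel at `y`. The
  -- combination then falls to a lower filtration step, although its own coordinate at `x` is
  -- `autCoord σ x' y ≠ 0`.
  have := coord_eq_zero_of_coord_aut σ (m := Γ.level x - 1)
    (a := autCoord σ x' y • gen k Γ x - autCoord σ x y • gen k Γ x')
    (sub_mem (Submodule.smul_mem _ _ (gen_mem_component k x))
      (Submodule.smul_mem _ _ (gen_mem_component k x')))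
    (fun z hz => by
      have hz' : coord k Γ (σ.1 (autCoord σ x' y • gen k Γ x - autCoord σ x y • gen k Γ x')) z =
          autCoord σ x' y * autCoord σ x z - autCoord σ x y * autCoord σ x' z := by
        simp [autCoord]
      rw [hz']
      rcases (show Γ.level x ≤ Γ.level z by omega).eq_or_lt with hzx | hzx
      · by_cases hzy : z = y
        · rw [hzy]; ring
        · have h₁ : autCoord σ x z = 0 := by_contra fun h₁ => hzy (h z hzx.symm h₁)
          have h₂ : autCoord σ x' z = 0 := by_contra fun h₂ => hzy (h' z hzx.symm h₂)
          rw [h₁, h₂]; ring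
      · rw [autCoord_of_lt σ hzx, autCoord_of_lt σ (hl.trans_lt hzx)]; ring) (x := x) (by omega)
  rw [map_sub, map_smul, map_smul, coord_gen, coord_gen, Pi.sub_apply, Pi.smul_apply,
    Pi.smul_apply, vec_self hx, show vec k Γ x' x = 0 by simp [vec, hne]] at this
  simp at this
  exact hy' this

end LevelParts

end LayeredGraph

/-! ### Quadratic equations for the polygon coordinates. -/

section PolygonCoordinates

variable {k : Type*} [Field k] {n : ℕ}

instance [NeZero n] : Finite (PolygonVertex n) :=
  Finite.of_injective
    (fun x : PolygonVertex n => match x with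
      | .star => (none : Option (Option (ZMod n ⊕ ZMod n)))
      | .u => some none
      | .w i => some (some (Sum.inl i))
      | .v i => some (some (Sum.inr i)))
    (by rintro (_ | _ | _ | _) (_ | _ | _ | _) h <;> simp_all)

noncomputable instance [NeZero n] : Fintype (polygonGraph n).V :=
  @Fintype.ofFinite _ (inferInstanceAs (Finite (PolygonVertex n)))

noncomputable instance : DecidableEq (PolygonVertex n) := Classical.decEq _

lemma polygon_vec {x : PolygonVertex n} (hx : x ≠ .star) :
    vec k (polygonGraph n) x = (Pi.single x 1 : PolygonVertex n → k) := by
  refine funext fun (y : PolygonVertex n) => ?_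
  by_cases h : y = x
  · rw [h, Pi.single_eq_same]
    exact if_pos ⟨rfl, hx⟩
  · rw [Pi.single_eq_of_ne h]
    exact if_neg fun h' => h h'.1

lemma polygon_coord_gen {x : PolygonVertex n} (hx : x ≠ .star) :
    coord k (polygonGraph n) (gen k (polygonGraph n) x) = (Pi.single x 1 : PolygonVertex n → k) :=
  (coord_gen _).trans (polygon_vec hx)

lemma polygon_vec_star : vec k (polygonGraph n) .star = (0 : PolygonVertex n → k) :=
  vec_star

/-- The coordinates of the images of the vertex generators of `A(Γ_{D_n})`. -/
noncomputable def polygonCoord (σ : autAlg k (polygonGraph n)) (x y : PolygonVertex n) : k :=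
  autCoord σ x y

/-- The equations satisfied by the coordinates of an automorphism, obtained from a bilinear form
that vanishes on the quadratic relations. -/
lemma polygon_form_eq {β : (PolygonVertex n → k) →ₗ[k] (PolygonVertex n → k) →ₗ[k] k}
    {c : ZMod n → k} {d : k}
    (h₁ : ∀ i, β (Pi.single (.v i) 1 - Pi.single (.w i) 1) (Pi.single (.w i) 1) = c i)
    (h₂ : ∀ i, β (Pi.single (.v i) 1 - Pi.single (.w (i + 1)) 1) (Pi.single (.w (i + 1)) 1) = c i)
    (h₃ : ∀ i, β (Pi.single .u 1 - Pi.single (.v i) 1) (Pi.single (.v i) 1) + c i = d)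
    (σ : autAlg k (polygonGraph n)) (i : ZMod n) :
    β (polygonCoord σ (.v i) - polygonCoord σ (.w i)) (polygonCoord σ (.w i)) =
        β (polygonCoord σ (.v i) - polygonCoord σ (.w (i + 1))) (polygonCoord σ (.w (i + 1))) ∧
      β (polygonCoord σ .u - polygonCoord σ (.v (i + 1)))
          (polygonCoord σ (.v (i + 1)) - polygonCoord σ (.w (i + 1))) =
        β (polygonCoord σ .u - polygonCoord σ (.v i))
          (polygonCoord σ (.v i) - polygonCoord σ (.w (i + 1))) := by
  have hβ : Admissible (Γ := polygonGraph n) β := by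
    -- The potential at a vertex is the value of `β` on `e(π, 2)` for a path `π` from it to `star`.
    refine ⟨fun | .star => 0 | .w _ => 0 | .v i => c i | .u => d, ?_⟩
    rintro (i | i | i | i)
    · change d = β (vec k (polygonGraph n) .u - vec k (polygonGraph n) (.v i))
        (vec k (polygonGraph n) (.v i)) + c i
      rw [polygon_vec (by simp), polygon_vec (by simp)]
      exact (h₃ i).symm
    · change c i = β (vec k (polygonGraph n) (.v i) - vec k (polygonGraph n) (.w i))
        (vec k (polygonGraph n) (.w i)) + 0
      rw [polygon_vec (by simp), polygon_vec (by simp), add_zero]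
      exact (h₁ i).symm
    · change c i = β (vec k (polygonGraph n) (.v i) - vec k (polygonGraph n) (.w (i + 1)))
        (vec k (polygonGraph n) (.w (i + 1))) + 0
      rw [polygon_vec (by simp), polygon_vec (by simp), add_zero]
      exact (h₂ i).symm
    · change 0 = β (vec k (polygonGraph n) (.w i) - vec k (polygonGraph n) .star)
        (vec k (polygonGraph n) .star) + 0
      rw [polygon_vec_star, add_zero]
      exact (map_zero _).symm
  -- The two equations come from the squares from `v i` to `star` and from `u` to `w (i + 1)`.
  constructor
  · have := form_autCoord_eq hβ σ (a := .vw i) (b := .ws i) (c := .vw' i) (d := .ws (i + 1))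
      rfl rfl rfl rfl
    have hs : autCoord σ ((polygonGraph n).head (.ws i)) = 0 := autCoord_star_left σ
    have hs' : autCoord σ ((polygonGraph n).head (.ws (i + 1))) = 0 := autCoord_star_left σ
    rw [hs, hs', sub_zero, sub_zero] at this
    exact this
  · exact form_autCoord_eq hβ σ (a := .uv (i + 1)) (b := .vw (i + 1)) (c := .uv i) (d := .vw' i)
      rfl rfl rfl rfl

section Entries

variable (σ : autAlg k (polygonGraph n))

@[simp] lemma polygonCoord_star (x : PolygonVertex n) : polygonCoord σ x .star = 0 :=
  autCoord_star_right σ x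

@[simp] lemma polygonCoord_w_v (i j : ZMod n) : polygonCoord σ (.w i) (.v j) = 0 :=
  autCoord_of_lt σ (show 1 < 2 by omega)

@[simp] lemma polygonCoord_w_u (i : ZMod n) : polygonCoord σ (.w i) .u = 0 :=
  autCoord_of_lt σ (show 1 < 3 by omega)

@[simp] lemma polygonCoord_v_u (i : ZMod n) : polygonCoord σ (.v i) .u = 0 :=
  autCoord_of_lt σ (show 2 < 3 by omega)

lemma exists_polygonCoord_w [NeZero n] (i : ZMod n) : ∃ j, polygonCoord σ (.w i) (.w j) ≠ 0 := by
  obtain ⟨y, hy, hy'⟩ := exists_autCoord_ne_zero σ (x := .w i) (show 0 < 1 by omega)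
  cases y with
  | w j => exact ⟨j, hy'⟩
  | _ => simp [polygonGraph] at hy

lemma exists_polygonCoord_v [NeZero n] (i : ZMod n) : ∃ j, polygonCoord σ (.v i) (.v j) ≠ 0 := by
  obtain ⟨y, hy, hy'⟩ := exists_autCoord_ne_zero σ (x := .v i) (show 0 < 2 by omega)
  cases y with
  | v j => exact ⟨j, hy'⟩
  | _ => simp [polygonGraph] at hy

lemma eq_of_polygonCoord_w_support [NeZero n] {i i' j : ZMod n}
    (h : ∀ l, polygonCoord σ (.w i) (.w l) ≠ 0 → l = j)
    (h' : ∀ l, polygonCoord σ (.w i') (.w l) ≠ 0 → l = j) : i = i' := by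
  refine PolygonVertex.w.inj (eq_of_autCoord_support σ (x := .w i) (x' := .w i') (y₀ := .w j)
    (show 0 < 1 by omega) rfl (fun y hy hy' => ?_) (fun y hy hy' => ?_))
  all_goals cases y with
  | w l => first | exact congrArg _ (h l hy') | exact congrArg _ (h' l hy')
  | _ => simp [polygonGraph] at hy

lemma eq_of_polygonCoord_v_support [NeZero n] {i i' j : ZMod n}
    (h : ∀ l, polygonCoord σ (.v i) (.v l) ≠ 0 → l = j)
    (h' : ∀ l, polygonCoord σ (.v i') (.v l) ≠ 0 → l = j) : i = i' := by
  refine PolygonVertex.v.inj (eq_of_autCoord_support σ (x := .v i) (x' := .v i') (y₀ := .v j)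
    (show 0 < 2 by omega) rfl (fun y hy hy' => ?_) (fun y hy hy' => ?_))
  all_goals cases y with
  | v l => first | exact congrArg _ (h l hy') | exact congrArg _ (h' l hy')
  | _ => simp [polygonGraph] at hy

variable (i : ZMod n)

/-- The form `v j ⊗ w l` is admissible with zero potential because no edge joins `v j` to `w l`. -/
lemma polygonCoord_eq_v_w {j l : ZMod n} (h₁ : l ≠ j) (h₂ : l ≠ j + 1) :
    polygonCoord σ (.v i) (.v j) *
      (polygonCoord σ (.w i) (.w l) - polygonCoord σ (.w (i + 1)) (.w l)) = 0 := by
  have := (polygon_form_eq (β := unitForm k (.v j) (.w l)) (c := 0) (d := 0)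
    (fun i => by simp [Pi.single_apply]; grind) (fun i => by simp [Pi.single_apply]; grind)
    (fun i => by simp [Pi.single_apply]) σ i).1
  simp at this
  rcases this with h | h <;> simp [h]

/-- The form is `v j ⊗ w j + v j ⊗ w (j + 1)`, with value `1` on both edges below `v j`. The term
`-u ⊗ v j` restores compatibility at `u`; it does not show in the conclusion, since images of sides
and corners have no `u` coordinate. -/
lemma polygonCoord_eq_v_w_add (hn : 3 ≤ n) (j : ZMod n) :
    polygonCoord σ (.v i) (.v j) *
      (polygonCoord σ (.w i) (.w j) - polygonCoord σ (.w (i + 1)) (.w j) +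
        (polygonCoord σ (.w i) (.w (j + 1)) - polygonCoord σ (.w (i + 1)) (.w (j + 1)))) = 0 := by
  have h1 (i : ZMod n) : i + 1 ≠ i := by simpa using ZMod.one_ne_zero_of_three_le hn
  have := (polygon_form_eq (β := unitForm k (.v j) (.w j) + unitForm k (.v j) (.w (j + 1)) -
      unitForm k .u (.v j)) (c := Pi.single j 1) (d := 0)
    (fun i => by
      rcases eq_or_ne i j with rfl | h
      · simp [h1]
      · simp [Pi.single_apply, h, h.symm])
    (fun i => by
      rcases eq_or_ne i j with rfl | h
      · simp [(h1 _).symm]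
      · simp [Pi.single_apply, h, h.symm])
    (fun i => by simp [Pi.single_apply]; grind) σ i).1
  simp at this
  linear_combination this

lemma polygonCoord_eq_w_w {j l : ZMod n} (h : j ≠ l) :
    polygonCoord σ (.v i) (.w j) *
        (polygonCoord σ (.w i) (.w l) - polygonCoord σ (.w (i + 1)) (.w l)) =
      polygonCoord σ (.w i) (.w j) * polygonCoord σ (.w i) (.w l) -
        polygonCoord σ (.w (i + 1)) (.w j) * polygonCoord σ (.w (i + 1)) (.w l) := by
  have := (polygon_form_eq (β := unitForm k (.w j) (.w l)) (c := 0) (d := 0)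
    (fun i => by simp [Pi.single_apply]; grind) (fun i => by simp [Pi.single_apply]; grind)
    (fun i => by simp) σ i).1
  simp at this
  linear_combination this

/-- On an edge into `w j` the form `w j ⊗ w j` takes the value `-1`; adding `v m ⊗ w j` for every
side `m` cancels it. -/
lemma polygonCoord_eq_w_self [NeZero n] (j : ZMod n) :
    (∑ m, polygonCoord σ (.v i) (.v m) + polygonCoord σ (.v i) (.w j)) *
        (polygonCoord σ (.w i) (.w j) - polygonCoord σ (.w (i + 1)) (.w j)) =
      polygonCoord σ (.w i) (.w j) ^ 2 - polygonCoord σ (.w (i + 1)) (.w j) ^ 2 := by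
  have := (polygon_form_eq (β := ∑ m, unitForm k (.v m) (.w j) + unitForm k (.w j) (.w j))
    (c := 0) (d := 0)
    (fun i => by simp [Pi.single_apply]; grind) (fun i => by simp [Pi.single_apply]; grind)
    (fun i => by simp) σ i).1
  simp [← Finset.sum_mul] at this
  linear_combination this

lemma polygonCoord_eq_v_v {j l : ZMod n} (h : j ≠ l) :
    (polygonCoord σ .u (.v j) - polygonCoord σ (.v (i + 1)) (.v j)) *
        polygonCoord σ (.v (i + 1)) (.v l) =
      (polygonCoord σ .u (.v j) - polygonCoord σ (.v i) (.v j)) *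
        polygonCoord σ (.v i) (.v l) := by
  have := (polygon_form_eq (β := unitForm k (.v j) (.v l)) (c := 0) (d := 0)
    (fun i => by simp [Pi.single_apply]) (fun i => by simp [Pi.single_apply])
    (fun i => by simp [Pi.single_apply]; grind) σ i).2
  simp at this
  linear_combination this

/-- The term `u ⊗ v j` cancels the value `-1` of `v j ⊗ v j` on the edge `u → v j`. -/
lemma polygonCoord_eq_v_self (j : ZMod n) :
    (polygonCoord σ .u .u + polygonCoord σ .u (.v j) - polygonCoord σ (.v (i + 1)) (.v j)) *
        polygonCoord σ (.v (i + 1)) (.v j) =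
      (polygonCoord σ .u .u + polygonCoord σ .u (.v j) - polygonCoord σ (.v i) (.v j)) *
        polygonCoord σ (.v i) (.v j) := by
  have := (polygon_form_eq (β := unitForm k .u (.v j) + unitForm k (.v j) (.v j)) (c := 0) (d := 0)
    (fun i => by simp [Pi.single_apply]) (fun i => by simp [Pi.single_apply])
    (fun i => by simp [Pi.single_apply]; grind) σ i).2
  simp at this
  linear_combination this

lemma polygonCoord_eq_w_v (j l : ZMod n) :
    (polygonCoord σ .u (.w j) - polygonCoord σ (.v (i + 1)) (.w j)) *
        polygonCoord σ (.v (i + 1)) (.v l) =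
      (polygonCoord σ .u (.w j) - polygonCoord σ (.v i) (.w j)) *
        polygonCoord σ (.v i) (.v l) := by
  have := (polygon_form_eq (β := unitForm k (.w j) (.v l)) (c := 0) (d := 0)
    (fun i => by simp [Pi.single_apply]) (fun i => by simp [Pi.single_apply])
    (fun i => by simp [Pi.single_apply]) σ i).2
  simp at this
  linear_combination this

end Entries

end PolygonCoordinates

/-! ### Rigidity of the polygon algebra. -/

section Rigidity

variable {k : Type*} [Field k] {n : ℕ}

lemma autCoord_injective {Γ : LayeredGraph} [Fintype Γ.V] (σ : autAlg k Γ) :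
    Function.Injective (autCoord σ) := fun x y hxy => by
  have h : gen k Γ x = gen k Γ y := σ.1.injective (by rw [aut_gen, aut_gen, hxy])
  have h' : vec k Γ x = vec k Γ y := by rw [← coord_gen, h, coord_gen]
  have hx := congrFun h' x
  have hy := congrFun h' y
  by_cases hxs : x = Γ.star <;> by_cases hys : y = Γ.star <;>
    by_cases hne : x = y <;> simp_all [vec]

lemma polygonCoord_w_injective [NeZero n] (σ : autAlg k (polygonGraph n)) {i j : ZMod n}
    (h : ∀ l, polygonCoord σ (.w i) (.w l) = polygonCoord σ (.w j) (.w l)) : i = j := by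
  have : polygonCoord σ (.w i) = polygonCoord σ (.w j) := by
    funext y; cases y <;> simp [h]
  exact PolygonVertex.w.inj (autCoord_injective σ this)

/-- Up to a scalar, an automorphism of `A(Γ_{D_n})` permutes the generators attached to the corners
and preserves the neighbourhood relation. -/
lemma exists_polygonCoord_w_eq (hn : 3 ≤ n) (σ : autAlg k (polygonGraph n)) :
    ∃ (τ : ZMod n → ZMod n) (α : k), Function.Injective τ ∧
      (∀ i, τ (i + 1) = τ i + 1 ∨ τ i = τ (i + 1) + 1) ∧ α ≠ 0 ∧
      ∀ i l, polygonCoord σ (.w i) (.w l) = if l = τ i then α else 0 := by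
  have : NeZero n := ⟨by omega⟩
  have h1 (i : ZMod n) : i + 1 ≠ i := by simpa using ZMod.one_ne_zero_of_three_le hn
  have h2 (i : ZMod n) : i + 1 + 1 ≠ i := by
    rw [add_assoc]; simpa using ZMod.one_add_one_ne_zero_of_three_le hn
  choose π hπ using exists_polygonCoord_v σ
  choose τ hτ using exists_polygonCoord_w σ
  -- The images of corners `i` and `i + 1` differ only at the two corners of the side `π i`, and
  -- there by opposite amounts (`hs`).
  have hd (i l : ZMod n) (h : l ≠ π i) (h' : l ≠ π i + 1) :
      polygonCoord σ (.w i) (.w l) = polygonCoord σ (.w (i + 1)) (.w l) :=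
    sub_eq_zero.1 ((mul_eq_zero.1 (polygonCoord_eq_v_w σ i h h')).resolve_left (hπ i))
  have hs (i : ZMod n) := (mul_eq_zero.1 (polygonCoord_eq_v_w_add σ i hn (π i))).resolve_left (hπ i)
  -- Otherwise the two images would coincide.
  have hne (i : ZMod n) : polygonCoord σ (.w i) (.w (π i)) -
      polygonCoord σ (.w (i + 1)) (.w (π i)) ≠ 0 := fun h => by
    refine h1 i (polygonCoord_w_injective σ fun l => ?_).symm
    by_cases hl : l = π i
    · rw [hl, sub_eq_zero.1 h]
    by_cases hl' : l = π i + 1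
    · rw [hl']
      exact sub_eq_zero.1 (by simpa [h] using hs i)
    · exact hd i l hl hl'
  have hne' (i : ZMod n) : polygonCoord σ (.w i) (.w (π i + 1)) -
      polygonCoord σ (.w (i + 1)) (.w (π i + 1)) ≠ 0 := fun h =>
    hne i (by simpa [h] using hs i)
  -- The difference is nonzero at both corners of `π i`, so any side `l` occurring in the image of
  -- `v i` must have these same two corners.
  have hB (i l : ZMod n) (hl : polygonCoord σ (.v i) (.v l) ≠ 0) : l = π i := by
    by_contra hlπ
    have h (m : ZMod n) (hm : polygonCoord σ (.w i) (.w m) -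
        polygonCoord σ (.w (i + 1)) (.w m) ≠ 0) : m = l ∨ m = l + 1 := by
      by_contra! hm'
      exact hm ((mul_eq_zero.1 (polygonCoord_eq_v_w σ i hm'.1 hm'.2)).resolve_left hl)
    have e₁ := (h _ (hne i)).resolve_left (Ne.symm hlπ)
    rcases h _ (hne' i) with e₂ | e₂
    · exact h2 l (e₁ ▸ e₂)
    · exact hlπ (add_right_cancel e₂).symm
  have hπ_inj : Function.Injective π := fun i j hij =>
    eq_of_polygonCoord_v_support σ (hB i) (fun l hl => hij ▸ hB j l hl)
  -- Outside the side `π i` both images have the same coordinate at `l`. The form `w (π i) ⊗ w l`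
  -- then makes this coordinate times the nonzero difference at `π i` vanish.
  have hA (i l : ZMod n) (hl : polygonCoord σ (.w i) (.w l) ≠ 0) : l = π i ∨ l = π i + 1 := by
    by_contra! h
    have := polygonCoord_eq_w_w σ i h.1.symm
    rw [← hd i l h.1 h.2, sub_self, mul_zero, ← sub_mul] at this
    exact (mul_ne_zero (hne i) hl) this.symm
  have hA' (i l : ZMod n) (hl : polygonCoord σ (.w (i + 1)) (.w l) ≠ 0) :
      l = π i ∨ l = π i + 1 := by
    by_contra! h
    exact (not_or.2 h) (hA i l (hd i l h.1 h.2 ▸ hl))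
  have hA₁ (i l : ZMod n) (hl : polygonCoord σ (.w i) (.w l) ≠ 0) : l = τ i := by
    -- Corner `j + 1` is an end of the sides `j` and `j + 1`, so its image is supported on the
    -- corners common to the distinct sides `π j` and `π (j + 1)`. For `n ≥ 3` there is at most one.
    obtain ⟨i, rfl⟩ : ∃ j, i = j + 1 := ⟨i - 1, by ring⟩
    have hp : π (i + 1) ≠ π i := fun h => h1 i (hπ_inj h)
    have a₁ := hA _ _ hl
    have a₂ := hA' _ _ hl
    have b₁ := hA _ _ (hτ (i + 1))
    have b₂ := hA' _ _ (hτ (i + 1))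
    have := h2 (π i)
    have := h2 (π (i + 1))
    grind
  have hτ_inj : Function.Injective τ := fun i j hij =>
    eq_of_polygonCoord_w_support σ (hA₁ i) (fun l hl => hij ▸ hA₁ j l hl)
  have hadj (i : ZMod n) : (τ i = π i ∧ τ (i + 1) = π i + 1) ∨
      (τ i = π i + 1 ∧ τ (i + 1) = π i) := by
    have hp : τ (i + 1) ≠ τ i := fun h => h1 i (hτ_inj h)
    have a₁ := hA _ _ (hτ i)
    have b₂ := hA' _ _ (hτ (i + 1))
    grind
  have hA₀ (i l : ZMod n) (hl : l ≠ τ i) : polygonCoord σ (.w i) (.w l) = 0 :=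
    by_contra fun h => hl (hA₁ i l h)
  -- With single supports, the cancellation in `hs` says that neighbouring scalars agree.
  have hval (i : ZMod n) : polygonCoord σ (.w (i + 1)) (.w (τ (i + 1))) =
      polygonCoord σ (.w i) (.w (τ i)) := by
    have hp : τ (i + 1) ≠ τ i := fun h => h1 i (hτ_inj h)
    have e₁ := hA₀ i _ hp
    have e₂ := hA₀ (i + 1) _ hp.symm
    have := hs i
    rcases hadj i with ⟨h, h'⟩ | ⟨h, h'⟩
    · rw [← h', ← h, e₁, e₂] at this
      linear_combination -this
    · rw [← h, ← h', e₁, e₂] at this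
      linear_combination -this
  refine ⟨τ, polygonCoord σ (.w 0) (.w (τ 0)), hτ_inj, fun i => ?_, hτ 0, fun i l => ?_⟩
  · rcases hadj i with ⟨h, h'⟩ | ⟨h, h'⟩
    · exact Or.inl (by rw [h, h'])
    · exact Or.inr (by rw [h, h'])
  · split_ifs with h
    · rw [h]
      clear h
      induction i using ZMod.induction_add_one with
      | h₀ => rfl
      | h i ih => rw [hval, ih]
    · exact hA₀ i l h

/-- An automorphism of `A(Γ_{D_n})` which fixes the generators attached to the corners is
trivial. -/
lemma polygon_aut_eq_one (hn : 3 ≤ n) {σ : autAlg k (polygonGraph n)}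
    (hσ : ∀ i l : ZMod n, polygonCoord σ (.w i) (.w l) = if l = i then 1 else 0) : σ = 1 := by
  have : NeZero n := ⟨by omega⟩
  have h1 (i : ZMod n) : i + 1 ≠ i := by simpa using ZMod.one_ne_zero_of_three_le hn
  have h1' (i : ZMod n) : i ≠ i + 1 := (h1 i).symm
  have h2 (i : ZMod n) : i + 1 + 1 ≠ i := by
    rw [add_assoc]; simpa using ZMod.one_add_one_ne_zero_of_three_le hn
  -- The difference of the images of corners `i` and `i + 1` is nonzero at both, so both must be
  -- corners of `l`; this forces `l = i`.
  have hB (i l : ZMod n) (hl : polygonCoord σ (.v i) (.v l) ≠ 0) : l = i := by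
    have h (m : ZMod n) (h : m ≠ l) (h' : m ≠ l + 1) :
        (if m = i then 1 else 0 : k) - (if m = i + 1 then 1 else 0) = 0 := by
      rw [← hσ i, ← hσ (i + 1)]
      exact (mul_eq_zero.1 (polygonCoord_eq_v_w σ i h h')).resolve_left hl
    have e₁ : i = l ∨ i = l + 1 := by
      by_contra! h'
      simpa [h1'] using h i h'.1 h'.2
    have e₂ : i + 1 = l ∨ i + 1 = l + 1 := by
      by_contra! h'
      simpa [h1] using h (i + 1) h'.1 h'.2
    have := h2 i
    have := h2 l
    grind
  have hB₀ (i l : ZMod n) (hl : l ≠ i) : polygonCoord σ (.v i) (.v l) = 0 :=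
    by_contra fun h => hl (hB i l h)
  -- The form is `w j ⊗ w l` with `l` an end of the side `i` different from `j`. The factor of the
  -- unknown is then `±1` and the right-hand side vanishes.
  have hC (i j : ZMod n) : polygonCoord σ (.v i) (.w j) = 0 := by
    by_cases h : j = i
    · have := polygonCoord_eq_w_w σ i (h.trans_ne (h1' i))
      simpa [hσ, h, h1, h1'] using this
    · have := polygonCoord_eq_w_w σ i h
      simpa [hσ, h, h1, h1'] using this
  have hB₁ (i : ZMod n) : polygonCoord σ (.v i) (.v i) = 1 := by
    have := polygonCoord_eq_w_self σ i i
    rw [Finset.sum_eq_single i (fun j _ hj => hB₀ i j hj) (by simp)] at this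
    simpa [hσ, hC, h1, h1'] using this
  have hUv (j : ZMod n) : polygonCoord σ .u (.v j) = 0 := by
    have := polygonCoord_eq_v_v σ j (h1' j)
    simpa [hB₁, hB₀ _ _ (h1 j), hB₀ _ _ (h1' j)] using this
  have hUu : polygonCoord σ .u .u = 1 := by
    have := polygonCoord_eq_v_self σ 0 (0 + 1)
    rw [hB₁, hB₀ _ _ (h1 0), hUv] at this
    linear_combination this
  have hUw (j : ZMod n) : polygonCoord σ .u (.w j) = 0 := by
    have := polygonCoord_eq_w_v σ 0 j (0 + 1)
    rw [hB₁, hB₀ _ _ (h1 0), hC] at this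
    linear_combination this
  refine autCoord_ext fun x => ?_
  rw [autCoord_one]
  cases x with
  | star => exact (autCoord_star_left σ).trans vec_star.symm
  | w i =>
    refine Eq.trans ?_ (polygon_vec (x := .w i) (by simp)).symm
    change polygonCoord σ (.w i) = _
    funext y
    cases y <;> simp [Pi.single_apply, hσ]
  | v i =>
    refine Eq.trans ?_ (polygon_vec (x := .v i) (by simp)).symm
    change polygonCoord σ (.v i) = _
    funext y
    cases y with
    | v j =>
      by_cases h : j = i
      · simp [h, hB₁]
      · simp [h, hB₀]
    | _ => simp [hC]
  | u =>
    refine Eq.trans ?_ (polygon_vec (x := .u) (by simp)).symm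
    change polygonCoord σ .u = _
    funext y
    cases y <;> simp [hUu, hUv, hUw]

lemma coord_injOn_component {Γ : LayeredGraph} [Fintype Γ.V] {a b : Alg k Γ}
    (ha : a ∈ component k Γ 1) (hb : b ∈ component k Γ 1) (h : coord k Γ a = coord k Γ b) :
    a = b := by
  rw [eq_sum_coord ha, eq_sum_coord hb, h]

/-- The action of `kˣ × D_n` on `A(Γ_{D_n})`. -/
noncomputable def polygonAction (k : Type*) [Field k] (n : ℕ) :
    kˣ × DihedralGroup n →* autAlg k (polygonGraph n) :=
  (scaledAut k (polygonGraph n)).comp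
    (MonoidHom.prodMap (MonoidHom.id kˣ) (DihedralGroup.toAutPolygon n))

lemma polygonAction_gen (α : kˣ) (g : DihedralGroup n) (x : PolygonVertex n) :
    (polygonAction k n (α, g)).1 (gen k (polygonGraph n) x) =
      (α : k) • gen k (polygonGraph n) ((DihedralGroup.toAutPolygon n g).1.1 x) :=
  scaledAut_gen _ _

lemma polygonAction_edge (α : kˣ) (g : DihedralGroup n) (e : PolygonEdge n) :
    (polygonAction k n (α, g)).1 (edge k (polygonGraph n) e) =
      (α : k) • edge k (polygonGraph n) ((DihedralGroup.toAutPolygon n g).1.2 e) :=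
  scaledAut_edge _ _

lemma polygonAction_bijective (hn : 3 ≤ n) : Function.Bijective (polygonAction k n) := by
  have : NeZero n := ⟨by omega⟩
  constructor
  · refine (injective_iff_map_eq_one _).2 ?_
    rintro ⟨α, g⟩ h
    have hw (j : ZMod n) : ∃ i, (DihedralGroup.toAutPolygon n g).1.1 (.w j) = .w i := by
      cases g
      · exact ⟨_, rfl⟩
      · exact ⟨_, rfl⟩
    choose τ hτ using hw
    have key (j : ZMod n) : (Pi.single (.w j) 1 : PolygonVertex n → k) =
        (α : k) • Pi.single (.w (τ j)) 1 := by
      have := polygonAction_gen α g (.w j)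
      rw [h, hτ] at this
      replace this := congrArg (coord k (polygonGraph n)) this
      rw [map_smul] at this
      exact (polygon_coord_gen (by simp)).symm.trans
        (this.trans (congrArg ((α : k) • ·) (polygon_coord_gen (by simp))))
    have hj (j : ZMod n) : τ j = j ∧ (α : k) = 1 := by
      have := congrFun (key j) (.w j)
      by_cases hj : j = τ j
      · rw [← hj] at this
        exact ⟨hj.symm, by simpa using this.symm⟩
      · simp [hj] at this
    refine Prod.ext (Units.ext (hj 0).2) (DihedralGroup.eq_one_of_toAutPolygon_w hn fun j => ?_)
    rw [hτ, (hj j).1]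
  · intro σ
    obtain ⟨τ, α, hinj, hadj, hα, hσ⟩ := exists_polygonCoord_w_eq hn σ
    obtain ⟨g, hg⟩ := DihedralGroup.exists_toAutPolygon_w hn hinj hadj
    refine ⟨(Units.mk0 α hα, g), ?_⟩
    -- After dividing by the action of `(α, g)`, which agrees with `σ` on the corners, the quotient
    -- fixes every corner.
    rw [← inv_mul_eq_one]
    refine polygon_aut_eq_one hn fun i l => ?_
    have key : σ.1 (gen k (polygonGraph n) (.w i)) =
        (polygonAction k n (Units.mk0 α hα, g)).1 (gen k (polygonGraph n) (.w i)) := by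
      refine coord_injOn_component (aut_mem_component σ (gen_mem_component k _))
        (aut_mem_component _ (gen_mem_component k _)) ?_
      rw [polygonAction_gen, hg, map_smul]
      refine Eq.trans ?_ (congrArg (α • ·) (polygon_coord_gen (x := .w (τ i)) (by simp)).symm)
      change polygonCoord σ (.w i) = α • (Pi.single (.w (τ i)) 1 : PolygonVertex n → k)
      funext y
      cases y <;> simp [Pi.single_apply, hσ]
    have hfix : ((polygonAction k n (Units.mk0 α hα, g))⁻¹ * σ).1
        (gen k (polygonGraph n) (.w i)) = gen k (polygonGraph n) (.w i) := by
      change (polygonAction k n (Units.mk0 α hα, g)).1.symm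
        (σ.1 (gen k (polygonGraph n) (.w i))) = _
      rw [key, AlgEquiv.symm_apply_apply]
    change coord k (polygonGraph n) (((polygonAction k n (Units.mk0 α hα, g))⁻¹ * σ).1
        (gen k (polygonGraph n) (.w i))) (.w l) = _
    rw [hfix]
    refine (congrFun (polygon_coord_gen (x := .w i) (by simp)) (.w l)).trans ?_
    simp [Pi.single_apply]

end Rigidity

/-! ### The digon: the shape of the matrices. -/

section Digon

variable {k : Type*} [Field k]

noncomputable instance : DecidableEq DigonVertex := Classical.decEq _

instance : Fintype DigonVertex :=
  ⟨⟨([.star, .v₁₂, .w₁, .w₂] : List DigonVertex), by simp⟩, by rintro (_ | _ | _ | _) <;> simp⟩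

instance : Fintype digonGraph.V := inferInstanceAs (Fintype DigonVertex)

/-- The vertices of `Γ_{D_2}` other than `star`, in the order of the coordinates. -/
def digonVertex : Fin 3 → digonGraph.V := ![DigonVertex.v₁₂, DigonVertex.w₁, DigonVertex.w₂]

lemma digon_sum {M : Type*} [AddCommMonoid M] (f : digonGraph.V → M) :
    ∑ y, f y = f .star + ∑ i, f (digonVertex i) := by
  rw [Fin.sum_univ_three]
  change f .star + (f .v₁₂ + (f .w₁ + (f .w₂ + 0))) = f .star + (f .v₁₂ + f .w₁ + f .w₂)
  rw [add_zero, add_assoc]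

lemma digonGen_eq (i : Fin 3) : digonGen k i = gen k digonGraph (digonVertex i) := by
  fin_cases i
  · exact proj_pathElem_one k (Γ := digonGraph) (x := .v₁₂) ⟨rfl, rfl, rfl⟩
  · exact proj_pathElem_one k (Γ := digonGraph) (x := .w₁) ⟨rfl, rfl⟩
  · exact proj_pathElem_one k (Γ := digonGraph) (x := .w₂) ⟨rfl, rfl⟩

/-- The coordinates of the images of the vertex generators of `A(Γ_{D_2})`. -/
noncomputable def digonCoord (σ : autAlg k digonGraph) (x y : DigonVertex) : k :=
  autCoord σ x y

lemma digon_vec {x : DigonVertex} (hx : x ≠ .star) :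
    vec k digonGraph x = (Pi.single x 1 : DigonVertex → k) := by
  refine funext fun (y : DigonVertex) => ?_
  by_cases h : y = x
  · rw [h, Pi.single_eq_same]
    exact if_pos ⟨rfl, hx⟩
  · rw [Pi.single_eq_of_ne h]
    exact if_neg fun h' => h h'.1

lemma digonVertex_ne_star (i : Fin 3) : digonVertex i ≠ digonGraph.star := by
  fin_cases i <;> exact DigonVertex.noConfusion

lemma digonVertex_injective : Function.Injective digonVertex := by
  intro i j h
  fin_cases i <;> fin_cases j <;> first | rfl | cases h

lemma digon_vec_apply (i j : Fin 3) :
    vec k digonGraph (digonVertex i) (digonVertex j) = (1 : Matrix (Fin 3) (Fin 3) k) i j := by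
  rcases eq_or_ne i j with rfl | h
  · rw [Matrix.one_apply_eq]
    exact if_pos ⟨rfl, digonVertex_ne_star i⟩
  · rw [Matrix.one_apply_ne h]
    exact if_neg fun h' => h (digonVertex_injective h'.1).symm

/-- The equation satisfied by the coordinates of an automorphism, obtained from a bilinear form
that vanishes on the quadratic relation. -/
lemma digon_form_eq {β : (DigonVertex → k) →ₗ[k] (DigonVertex → k) →ₗ[k] k} {c : k}
    (h₁ : β (Pi.single .v₁₂ 1 - Pi.single .w₁ 1) (Pi.single .w₁ 1) = c)
    (h₂ : β (Pi.single .v₁₂ 1 - Pi.single .w₂ 1) (Pi.single .w₂ 1) = c)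
    (σ : autAlg k digonGraph) :
    β (digonCoord σ .v₁₂ - digonCoord σ .w₁) (digonCoord σ .w₁) =
      β (digonCoord σ .v₁₂ - digonCoord σ .w₂) (digonCoord σ .w₂) := by
  have hs : vec k digonGraph .star = (0 : DigonVertex → k) := vec_star
  have hβ : Admissible (Γ := digonGraph) β := by
    refine ⟨fun | .star => 0 | .w₁ => 0 | .w₂ => 0 | .v₁₂ => c, ?_⟩
    rintro (_ | _ | _ | _)
    · change c = β (vec k digonGraph .v₁₂ - vec k digonGraph .w₁) (vec k digonGraph .w₁) + 0
      rw [digon_vec (by simp), digon_vec (by simp), add_zero]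
      exact h₁.symm
    · change c = β (vec k digonGraph .v₁₂ - vec k digonGraph .w₂) (vec k digonGraph .w₂) + 0
      rw [digon_vec (by simp), digon_vec (by simp), add_zero]
      exact h₂.symm
    · change 0 = β (vec k digonGraph .w₁ - vec k digonGraph .star) (vec k digonGraph .star) + 0
      rw [hs, add_zero]
      exact (map_zero _).symm
    · change 0 = β (vec k digonGraph .w₂ - vec k digonGraph .star) (vec k digonGraph .star) + 0
      rw [hs, add_zero]
      exact (map_zero _).symm
  have := form_autCoord_eq hβ σ (a := .f₁) (b := .g₁) (c := .f₂) (d := .g₂) rfl rfl rfl rfl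
  have e₁ : autCoord σ (digonGraph.head .g₁) = 0 := autCoord_star_left σ
  have e₂ : autCoord σ (digonGraph.head .g₂) = 0 := autCoord_star_left σ
  rw [e₁, e₂, sub_zero, sub_zero] at this
  exact this

/-- The matrix of an automorphism of `A(Γ_{D_2})` on row vectors of coordinates. -/
noncomputable def digonAutMatrix (σ : autAlg k digonGraph) : Matrix (Fin 3) (Fin 3) k :=
  fun i j => digonCoord σ (digonVertex i) (digonVertex j)

lemma digonAutMatrix_gen (σ : autAlg k digonGraph) (i : Fin 3) :
    σ.1 (gen k digonGraph (digonVertex i)) =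
      ∑ j, digonAutMatrix σ i j • gen k digonGraph (digonVertex j) := by
  rw [aut_gen, digon_sum]
  change autCoord σ _ digonGraph.star • gen k digonGraph digonGraph.star + _ = _
  rw [gen_star, smul_zero, zero_add]
  rfl

lemma digonAutMatrix_one : digonAutMatrix (1 : autAlg k digonGraph) = 1 := by
  ext i j
  rw [← digon_vec_apply]
  exact congrFun (autCoord_one _) _

/-- Row-vector coordinates reverse products, which is why `digonAutGL` uses `σ⁻¹`. -/
lemma digonAutMatrix_mul (σ τ : autAlg k digonGraph) :
    digonAutMatrix (σ * τ) = digonAutMatrix τ * digonAutMatrix σ := by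
  ext i j
  refine (congrFun (autCoord_mul σ τ (digonVertex i)) (digonVertex j)).trans ?_
  rw [digon_sum]
  change (autCoord τ _ digonGraph.star • autCoord σ digonGraph.star + _ : digonGraph.V → k) _ = _
  rw [autCoord_star_left, smul_zero, zero_add, Matrix.mul_apply, Finset.sum_apply]
  rfl

lemma digonAutMatrix_injective :
    Function.Injective (digonAutMatrix : autAlg k digonGraph → Matrix (Fin 3) (Fin 3) k) := by
  intro σ τ h
  have key (i : Fin 3) : σ.1 (gen k digonGraph (digonVertex i)) =
      τ.1 (gen k digonGraph (digonVertex i)) := by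
    rw [digonAutMatrix_gen, digonAutMatrix_gen, h]
  refine autAlg_ext fun x => ?_
  cases x with
  | star =>
    change σ.1 (gen k digonGraph digonGraph.star) = τ.1 (gen k digonGraph digonGraph.star)
    rw [gen_star, map_zero, map_zero]
  | v₁₂ => exact key 0
  | w₁ => exact key 1
  | w₂ => exact key 2

/-- The matrix of an automorphism of `A(Γ_{D_2})` has the prescribed shape. -/
lemma digonAutMatrix_eq (σ : autAlg k digonGraph) :
    digonAutMatrix σ = digonMatrix (digonCoord σ .w₁ .w₁) (digonCoord σ .w₁ .w₂)
      (digonCoord σ .w₂ .w₁) := by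
  have z₁ : digonCoord σ .w₁ .v₁₂ = 0 := autCoord_of_lt σ (show 1 < 2 by omega)
  have z₂ : digonCoord σ .w₂ .v₁₂ = 0 := autCoord_of_lt σ (show 1 < 2 by omega)
  have hB : digonCoord σ .v₁₂ .v₁₂ ≠ 0 := by
    obtain ⟨y, hy, hy'⟩ := exists_autCoord_ne_zero σ (x := .v₁₂) (show 0 < 2 by omega)
    cases y with
    | v₁₂ => exact hy'
    | _ => simp [digonGraph] at hy
  -- `e₁` will equate the row sums of `w₁` and `w₂`. The other three forms, which vanish on both
  -- sides of the square, determine the row of `v₁₂`.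
  have e₁ := digon_form_eq (β := unitForm k .v₁₂ .w₁ + unitForm k .v₁₂ .w₂) (c := 1)
    (by simp) (by simp) σ
  have e₂ := digon_form_eq (β := unitForm k .w₁ .w₂) (c := 0) (by simp) (by simp) σ
  have e₃ := digon_form_eq (β := unitForm k .w₂ .w₁) (c := 0) (by simp) (by simp) σ
  have e₄ := digon_form_eq (β := unitForm k .v₁₂ .w₁ + unitForm k .w₁ .w₁) (c := 0)
    (by simp) (by simp) σ
  simp [z₁, z₂] at e₁ e₂ e₃ e₄
  have hΔ : digonCoord σ .w₂ .w₂ =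
      digonCoord σ .w₁ .w₁ + digonCoord σ .w₁ .w₂ - digonCoord σ .w₂ .w₁ := by
    refine mul_left_cancel₀ hB ?_
    linear_combination -e₁
  -- Since the row sums agree, equality here would make the images of `w₁` and `w₂` coincide.
  have hne : digonCoord σ .w₁ .w₁ - digonCoord σ .w₂ .w₁ ≠ 0 := fun h => by
    have : (DigonVertex.w₁ : DigonVertex) = .w₂ := autCoord_injective σ <| by
      refine funext fun (y : DigonVertex) => ?_
      change digonCoord σ .w₁ y = digonCoord σ .w₂ y
      cases y with
      | star => exact (autCoord_star_right σ _).trans (autCoord_star_right σ _).symm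
      | v₁₂ => rw [z₁, z₂]
      | w₁ => exact sub_eq_zero.1 h
      | w₂ => linear_combination -hΔ - h
    cases this
  rw [hΔ] at e₂ e₃
  have hC₁ : digonCoord σ .v₁₂ .w₁ = digonCoord σ .w₂ .w₁ - digonCoord σ .w₁ .w₂ := by
    refine mul_left_cancel₀ hne ?_
    linear_combination -e₂
  have hC₂ : digonCoord σ .v₁₂ .w₂ = digonCoord σ .w₁ .w₂ - digonCoord σ .w₂ .w₁ := by
    refine mul_left_cancel₀ hne ?_
    linear_combination e₃
  have hB' : digonCoord σ .v₁₂ .v₁₂ = digonCoord σ .w₁ .w₁ + digonCoord σ .w₁ .w₂ := by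
    refine mul_left_cancel₀ hne ?_
    rw [hC₁] at e₄
    linear_combination e₄
  ext i j
  fin_cases i <;> fin_cases j
  · exact hB'
  · exact hC₁
  · exact hC₂
  · exact z₁
  · rfl
  · rfl
  · exact z₂
  · rfl
  · exact hΔ

/-- The invertible matrix attached to the inverse of an automorphism of `A(Γ_{D_2})`. -/
noncomputable def digonAutGL : autAlg k digonGraph →* Matrix.GeneralLinearGroup (Fin 3) k where
  toFun σ := ⟨digonAutMatrix σ⁻¹, digonAutMatrix σ,
    by rw [← digonAutMatrix_mul, mul_inv_cancel, digonAutMatrix_one],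
    by rw [← digonAutMatrix_mul, inv_mul_cancel, digonAutMatrix_one]⟩
  map_one' := Units.ext <| by
    change digonAutMatrix (1 : autAlg k digonGraph)⁻¹ = 1
    rw [inv_one, digonAutMatrix_one]
  map_mul' σ τ := Units.ext <| by
    change digonAutMatrix (σ * τ)⁻¹ = digonAutMatrix σ⁻¹ * digonAutMatrix τ⁻¹
    rw [mul_inv_rev, digonAutMatrix_mul]

lemma digonAutGL_injective : Function.Injective (digonAutGL (k := k)) := fun _ _ h =>
  inv_injective (digonAutMatrix_injective (congrArg Units.val h))

/-! ### The digon: every invertible matrix of the shape occurs. -/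

section Realization

/-- With `d = x - y` the relation reads `v d = x² - y²`. The new difference is `(a - c) d`, so its
product with the new `v` is `(a - c) ((a + b) (x² - y²) + (c - b) d²)`, which expands to the
difference of the new squares. -/
lemma digon_relation {B : Type*} [Ring B] [Algebra k B] {v x y : B}
    (h : (v - x) * x = (v - y) * y) (a b c : k) :
    ((a + b) • v + (c - b) • x + (b - c) • y - (a • x + b • y)) * (a • x + b • y) =
      ((a + b) • v + (c - b) • x + (b - c) • y - (c • x + (a + b - c) • y)) *
        (c • x + (a + b - c) • y) := by
  have h' : v * x = v * y + x * x - y * y := by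
    rw [sub_mul, sub_mul] at h
    rw [eq_add_of_sub_eq h]; abel
  simp only [mul_add, add_mul, sub_mul, smul_mul_smul_comm, h']
  module

lemma digon_gen_relation (k : Type*) [Field k] :
    (gen k digonGraph .v₁₂ - gen k digonGraph .w₁) * gen k digonGraph .w₁ =
      (gen k digonGraph .v₁₂ - gen k digonGraph .w₂) * gen k digonGraph .w₂ := by
  have hg (e : digonGraph.E) (he : digonGraph.head e = digonGraph.star) :
      edge k digonGraph e = gen k digonGraph (digonGraph.tail e) := by
    rw [edge_eq_gen_sub, he, gen_star, sub_zero]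
  exact (congrArg₂ (· * ·) (edge_eq_gen_sub k (Γ := digonGraph) .f₁) (hg .g₁ rfl)).symm.trans <|
    (edge_mul_edge_eq k (Γ := digonGraph) (a := .f₁) (b := .g₁) (c := .f₂) (d := .g₂)
      rfl rfl rfl rfl).trans
    (congrArg₂ (· * ·) (edge_eq_gen_sub k (Γ := digonGraph) .f₂) (hg .g₂ rfl))

/-- The vertex values of the endomorphism of `A(Γ_{D_2})` with parameters `a`, `b`, `c`. -/
noncomputable def digonValue (a b c : k) : digonGraph.V → Alg k digonGraph
  | .star => 0
  | .v₁₂ => (a + b) • gen k digonGraph .v₁₂ + (c - b) • gen k digonGraph .w₁ +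
      (b - c) • gen k digonGraph .w₂
  | .w₁ => a • gen k digonGraph .w₁ + b • gen k digonGraph .w₂
  | .w₂ => c • gen k digonGraph .w₁ + (a + b - c) • gen k digonGraph .w₂

lemma digonValue_mem (a b c : k) (x : digonGraph.V) :
    digonValue a b c x ∈ component k digonGraph 1 ∧
      digonValue a b c x ∈ filtration k digonGraph (digonGraph.level x) := by
  have hv := gen_mem_filtration k (Γ := digonGraph) .v₁₂
  have h₁ := gen_mem_filtration k (Γ := digonGraph) .w₁
  have h₂ := gen_mem_filtration k (Γ := digonGraph) .w₂
  have h₁' := filtration_mono k (show 1 ≤ 2 by omega) h₁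
  have h₂' := filtration_mono k (show 1 ≤ 2 by omega) h₂
  have hc := gen_mem_component k (Γ := digonGraph)
  cases x with
  | star => exact ⟨zero_mem _, zero_mem _⟩
  | v₁₂ =>
    exact ⟨add_mem (add_mem (Submodule.smul_mem _ _ (hc _)) (Submodule.smul_mem _ _ (hc _)))
      (Submodule.smul_mem _ _ (hc _)),
      add_mem (add_mem (Submodule.smul_mem _ _ hv) (Submodule.smul_mem _ _ h₁'))
      (Submodule.smul_mem _ _ h₂')⟩
  | w₁ =>
    exact ⟨add_mem (Submodule.smul_mem _ _ (hc _)) (Submodule.smul_mem _ _ (hc _)),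
      add_mem (Submodule.smul_mem _ _ h₁) (Submodule.smul_mem _ _ h₂)⟩
  | w₂ =>
    exact ⟨add_mem (Submodule.smul_mem _ _ (hc _)) (Submodule.smul_mem _ _ (hc _)),
      add_mem (Submodule.smul_mem _ _ h₁) (Submodule.smul_mem _ _ h₂)⟩

/-- The endomorphism of `A(Γ_{D_2})` with parameters `a`, `b`, `c`. -/
noncomputable def digonHom (a b c : k) : Alg k digonGraph →ₐ[k] Alg k digonGraph :=
  liftAlg (fun e => digonValue a b c (digonGraph.tail e) - digonValue a b c (digonGraph.head e)) <|
    lift_pathElem_eq (g := digonValue a b c)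
      (φ := fun
        | .v₁₂ => (digonValue a b c .v₁₂ - digonValue a b c .w₁) * digonValue a b c .w₁
        | _ => 0)
      (fun _ => rfl)
      (by
        rintro (_ | _ | _ | _)
        · exact (add_zero _).symm
        · refine Eq.trans ?_ (add_zero _).symm
          exact digon_relation (digon_gen_relation k) a b c
        · exact ((add_zero _).trans (mul_zero _)).symm
        · exact ((add_zero _).trans (mul_zero _)).symm)
      -- Paths have length at most two, so there are no terms of degree three or more.
      (fun x y π h m => by
        have hl := h.level_eq
        have hx : digonGraph.level x ≤ 2 := by cases x <;> exact Nat.le_of_ble_eq_true rfl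
        rw [pathElem_of_length_lt (by omega), map_zero])

lemma digonHom_edge (a b c : k) (e : digonGraph.E) :
    digonHom a b c (edge k digonGraph e) =
      digonValue a b c (digonGraph.tail e) - digonValue a b c (digonGraph.head e) :=
  liftAlg_edge _ _ e

lemma digonHom_edge_mem (a b c : k) (e : digonGraph.E) :
    digonHom a b c (edge k digonGraph e) ∈ component k digonGraph 1 ∧
      digonHom a b c (edge k digonGraph e) ∈
        filtration k digonGraph (digonGraph.level (digonGraph.tail e)) := by
  rw [digonHom_edge]
  have ht := digonValue_mem a b c (digonGraph.tail e)
  have hh := digonValue_mem a b c (digonGraph.head e)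
  exact ⟨sub_mem ht.1 hh.1,
    sub_mem ht.2 (filtration_mono k (by have := digonGraph.level_tail e; omega) hh.2)⟩

lemma digonHom_gen (a b c : k) (x : digonGraph.V) :
    digonHom a b c (gen k digonGraph x) = digonValue a b c x := by
  have hs : digonHom a b c (gen k digonGraph digonGraph.star) = 0 := by rw [gen_star, map_zero]
  have key (e : digonGraph.E)
      (h : digonHom a b c (gen k digonGraph (digonGraph.head e)) =
        digonValue a b c (digonGraph.head e)) :
      digonHom a b c (gen k digonGraph (digonGraph.tail e)) =
        digonValue a b c (digonGraph.tail e) := by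
    have := digonHom_edge a b c e
    rw [edge_eq_gen_sub, map_sub, h] at this
    exact sub_left_injective this
  cases x with
  | star => exact hs
  | w₁ => exact key .g₁ hs
  | w₂ => exact key .g₂ hs
  | v₁₂ => exact key .f₁ (key .g₁ hs)

lemma digonHom_gen_eq_sum (a b c : k) (i : Fin 3) :
    digonHom a b c (gen k digonGraph (digonVertex i)) =
      ∑ j, digonMatrix a b c i j • gen k digonGraph (digonVertex j) := by
  rw [digonHom_gen, Fin.sum_univ_three]
  fin_cases i
  · rfl
  · change _ = (0 : k) • gen k digonGraph .v₁₂ + a • gen k digonGraph .w₁ +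
      b • gen k digonGraph .w₂
    rw [zero_smul, zero_add]
    rfl
  · change _ = (0 : k) • gen k digonGraph .v₁₂ + c • gen k digonGraph .w₁ +
      (a + b - c) • gen k digonGraph .w₂
    rw [zero_smul, zero_add]
    rfl

lemma digonHom_comp {a b c a' b' c' : k} (h : digonMatrix a' b' c' * digonMatrix a b c = 1) :
    (digonHom a b c).comp (digonHom a' b' c') = AlgHom.id k (Alg k digonGraph) := by
  have key (i : Fin 3) : digonHom a b c (digonHom a' b' c' (gen k digonGraph (digonVertex i))) =
      gen k digonGraph (digonVertex i) := by
    simp only [digonHom_gen_eq_sum, map_sum, map_smul, Finset.smul_sum, smul_smul]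
    rw [Finset.sum_comm]
    simp only [← Finset.sum_smul, ← Matrix.mul_apply, h]
    simp [Matrix.one_apply]
  have key' (x : digonGraph.V) : digonHom a b c (digonHom a' b' c' (gen k digonGraph x)) =
      gen k digonGraph x := by
    cases x with
    | star =>
      change digonHom a b c (digonHom a' b' c' (gen k digonGraph digonGraph.star)) =
        gen k digonGraph digonGraph.star
      rw [gen_star, map_zero, map_zero]
    | v₁₂ => exact key 0
    | w₁ => exact key 1
    | w₂ => exact key 2
  refine algHom_ext fun e => ?_
  rw [AlgHom.comp_apply, edge_eq_gen_sub, map_sub, map_sub, key', key']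
  rfl

lemma digonMatrix_det (a b c : k) : (digonMatrix a b c).det = (a + b) ^ 2 * (a - c) := by
  rw [digonMatrix, Matrix.det_fin_three]
  simp
  ring

/-- The parameters are read off from the inverse of the lower right block, whose determinant is `(a
+ b) (a - c)`; the remaining entries then fit the shape. -/
lemma digonMatrix_mul_inverse {a b c : k} (h₁ : a + b ≠ 0) (h₂ : a - c ≠ 0) :
    digonMatrix a b c * digonMatrix ((a + b - c) / ((a + b) * (a - c)))
      (-b / ((a + b) * (a - c))) (-c / ((a + b) * (a - c))) = 1 := by
  ext i j
  fin_cases i <;> fin_cases j <;>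
    simp [digonMatrix, Matrix.mul_apply, Fin.sum_univ_three] <;> field_simp <;> ring

/-- Every invertible matrix of the prescribed shape comes from an automorphism. -/
lemma exists_digonAutMatrix_eq {a b c : k} (h : IsUnit (digonMatrix a b c)) :
    ∃ σ : autAlg k digonGraph, digonAutMatrix σ = digonMatrix a b c := by
  have hdet : (a + b) ^ 2 * (a - c) ≠ 0 := by
    rw [← digonMatrix_det]
    exact ((Matrix.isUnit_iff_isUnit_det _).1 h).ne_zero
  have h₁ : a + b ≠ 0 := fun h => hdet (by rw [h]; ring)
  have h₂ : a - c ≠ 0 := fun h => hdet (by rw [h]; ring)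
  have hinv := digonMatrix_mul_inverse h₁ h₂
  refine ⟨⟨AlgEquiv.ofAlgHom (digonHom a b c) (digonHom _ _ _)
    (digonHom_comp (mul_eq_one_comm.1 hinv)) (digonHom_comp hinv),
    mem_autAlg (fun e => digonHom_edge_mem _ _ _ e) (fun e => digonHom_edge_mem _ _ _ e)⟩, ?_⟩
  ext i j
  change coord k digonGraph (digonHom a b c (gen k digonGraph (digonVertex i))) (digonVertex j) = _
  rw [digonHom_gen_eq_sum, map_sum, Finset.sum_apply]
  simp only [map_smul, coord_gen, Pi.smul_apply, digon_vec_apply, smul_eq_mul]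
  rw [← Matrix.mul_apply, mul_one]

end Realization

lemma mem_range_digonAutGL {M : Matrix.GeneralLinearGroup (Fin 3) k} :
    M ∈ (digonAutGL (k := k)).range ↔
      ∃ a b c : k, (M : Matrix (Fin 3) (Fin 3) k) = digonMatrix a b c := by
  constructor
  · rintro ⟨σ, rfl⟩
    exact ⟨_, _, _, digonAutMatrix_eq σ⁻¹⟩
  · rintro ⟨a, b, c, h⟩
    obtain ⟨σ, hσ⟩ := exists_digonAutMatrix_eq (h ▸ M.isUnit)
    refine ⟨σ⁻¹, Units.ext ?_⟩
    change digonAutMatrix σ⁻¹⁻¹ = _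
    rw [inv_inv, hσ, h]

end Digon

/-- Part (a): `(α, g)` acts on `A(Γ_{D_n})` by `e ↦ α • g e` on edges, where `D_n` acts on the graph
by rotations and reflections, and this identifies `kˣ × D_n` with `Aut(A(Γ_{D_n}))`.
Part (b): the matrices form a group isomorphic to `Aut(A(Γ_{D_2}))`; matrices act on row vectors
of coordinates, which reverses products, hence the inverse. -/
theorem theoremT (k : Type*) [Field k] :
    (∀ n : ℕ, 3 ≤ n →
      ∃ (δ : DihedralGroup n ≃* (polygonGraph n).autGraph)
        (Φ : kˣ × DihedralGroup n ≃* LayeredGraph.autAlg k (polygonGraph n)),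
        (∀ i j : ZMod n,
          (δ (DihedralGroup.r i)).1.1 (PolygonVertex.w j) = PolygonVertex.w (j + i)) ∧
        (∀ i j : ZMod n,
          (δ (DihedralGroup.sr i)).1.1 (PolygonVertex.w j) = PolygonVertex.w (-j - i)) ∧
        (∀ (α : kˣ) (g : DihedralGroup n) (e : PolygonEdge n),
          (Φ (α, g)).1 (LayeredGraph.edge k (polygonGraph n) e) =
            (α : k) • LayeredGraph.edge k (polygonGraph n) ((δ g).1.2 e))) ∧
    (∃ H : Subgroup (Matrix.GeneralLinearGroup (Fin 3) k),
      (∀ M : Matrix.GeneralLinearGroup (Fin 3) k,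
        M ∈ H ↔ ∃ a b c : k, (M : Matrix (Fin 3) (Fin 3) k) = digonMatrix a b c) ∧
      ∃ Φ : LayeredGraph.autAlg k digonGraph ≃* H,
        ∀ (σ : LayeredGraph.autAlg k digonGraph) (i : Fin 3),
          σ.1 (digonGen k i) =
            ∑ j : Fin 3, (((Φ σ)⁻¹ : H) : Matrix.GeneralLinearGroup (Fin 3) k) i j •
              digonGen k j) := by
  refine ⟨fun n hn => ?_, digonAutGL.range, fun M => mem_range_digonAutGL,
    digonAutGL.ofInjective digonAutGL_injective, fun σ i => ?_⟩
  · exact ⟨MulEquiv.ofBijective _ (DihedralGroup.toAutPolygon_bijective hn),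
      MulEquiv.ofBijective _ (polygonAction_bijective hn),
      DihedralGroup.toAutPolygon_r_w, DihedralGroup.toAutPolygon_sr_w, polygonAction_edge⟩
  · simp only [digonGen_eq]
    exact digonAutMatrix_gen σ i
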